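/- Let $N\ge 1$, $0=\rho_0\le\rho_1\le\dots\le\rho_N=\rho_{\max}$, and let $\psi:[0,\rho_{\max}]\to[0,\infty)$ satisfy $\psi=\varphi_n$ on $[\rho_{n-1},\rho_n)$ for $n<N$ and $\psi=\varphi_N$ on $[\rho_{N-1},\rho_{\max}]$, where $\varphi_n$ is monotone increasing for odd $n$ and monotone decreasing for even $n$. Let $h\in\mathbb C\setminus\{0\}$, $\sigma>0$, $A\ge 0$, $\bar A=\min\{A,\sqrt{\rho_{\max}}/|h|\}$, and assume that $\bar P_{\max}=\max_{\rho\in[0,|h\bar A|^2]}\psi(\rho)$ exists. For a probability distribution $f_s$ on $[0,\bar A]$ (point masses are allowed), let $s\sim f_s$, $x=\sqrt{\psi(|hs|^2)}$, and $y=x+n$ with $n\sim\mathcal N(0,\sigma^2)$ independent of $s$. Let $I(f_s)$ be the mutual information in nats between $s$ and $y$, and let $$J(f_s)=\tfrac12\ln\Big(1+\frac{e^{2h_x(f_s)}}{2\pi e\sigma^2}\Big),$$ where $h_x(f_s)$ is the differential entropy of $x$ ($-\infty$ if $x$ has no density, with $e^{-\infty}=0$). For $\bar P^{\rm req}\in[0,\bar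 P_{\max}]$ let $\bar{\mathcal F}$ be the set of probability distributions $f_s$ on $[0,\bar A]$ with $\mathbb E\,\psi(|hs|^2)\ge\bar P^{\rm req}$. Then $$I^*:=\sup_{f_s\in\bar{\mathcal F}}I(f_s)\ \ge\ \sup_{f_s\in\bar{\mathcal F}}J(f_s)=:J^*.$$ Moreover, if $\psi$ is continuous on $[0,\rho_{\max}]$, then both suprema are attained, i.e. $I^*=\max_{f_s\in\bar{\mathcal F}}I(f_s)\ge\max_{f_s\in\bar{\mathcal F}}J(f_s)=J^*$. -/

import Mathlib

open MeasureTheory ProbabilityTheory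
open scoped ENNReal NNReal

noncomputable section

/-- A piecewise monotone energy-harvesting (EH) model: break points
`0 = ρ₀ ≤ ρ₁ ≤ ⋯ ≤ ρ_N` and non-negative functions `φ`, one for each of the `N` pieces, that are
alternately increasing and decreasing. The pieces are numbered from `0` here, so piece `i` lies
between `ρ_i` and `ρ_{i+1}` and the increasing pieces are those with even `i`. -/
structure EHModel where
  /-- number of pieces -/
  N : ℕ
  N_pos : 0 < N
  /-- break points -/
  ρ : Fin (N + 1) → ℝ
  ρ_zero : ρ 0 = 0
  ρ_mono : Monotone ρ
  /-- harvested power on each piece -/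
  φ : Fin N → ℝ → ℝ
  φ_nonneg : ∀ i : Fin N, ∀ r ∈ Set.Icc (ρ i.castSucc) (ρ i.succ),
    ((i : ℕ) + 1 < N → r < ρ i.succ) → 0 ≤ φ i r
  φ_monotone : ∀ i : Fin N, Even (i : ℕ) →
    MonotoneOn (φ i) {r ∈ Set.Icc (ρ i.castSucc) (ρ i.succ) | (i : ℕ) + 1 < N → r < ρ i.succ}
  φ_antitone : ∀ i : Fin N, Odd (i : ℕ) →
    AntitoneOn (φ i) {r ∈ Set.Icc (ρ i.castSucc) (ρ i.succ) | (i : ℕ) + 1 < N → r < ρ i.succ}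

namespace EHModel

/-- The largest received power that the circuit tolerates. -/
def ρmax (M : EHModel) : ℝ := M.ρ (Fin.last M.N)

/-- The domain of the `i`-th function: half-open on the right, except that the last one is
closed. -/
def piece (M : EHModel) (i : Fin M.N) : Set ℝ :=
  {r ∈ Set.Icc (M.ρ i.castSucc) (M.ρ i.succ) | (i : ℕ) + 1 < M.N → r < M.ρ i.succ}

/-- The harvested power as a function of the received power `r`: equal to `φ i r` on the `i`-th
piece (see `psi_of_mem_piece`). Its domain is `[0, ρmax]`; outside it takes the irrelevant
value `0`. -/
def psi (M : EHModel) (r : ℝ) : ℝ := ∑ i : Fin M.N, (M.piece i).indicator (M.φ i) r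

lemma not_mem_piece_of_lt (M : EHModel) {i j : Fin M.N} (hij : i < j) {r : ℝ}
    (hi : r ∈ M.piece i) : r ∉ M.piece j := by
  intro hj
  have h1 : r < M.ρ i.succ := hi.2 (by have := j.2; have : (i : ℕ) < j := hij; omega)
  have h2 : M.ρ i.succ ≤ M.ρ j.castSucc := M.ρ_mono (by
    rw [Fin.le_def]; simp only [Fin.val_succ, Fin.val_castSucc]
    have : (i : ℕ) < j := hij
    omega)
  exact absurd (h1.trans_le (h2.trans hj.1.1)) (lt_irrefl r)

lemma psi_of_mem_piece (M : EHModel) (i : Fin M.N) {r : ℝ} (hr : r ∈ M.piece i) :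
    M.psi r = M.φ i r := by
  unfold psi
  rw [Finset.sum_eq_single i]
  · exact Set.indicator_of_mem hr _
  · intro j _ hj
    apply Set.indicator_of_notMem
    rcases lt_or_gt_of_ne hj with h | h
    · exact fun h' => M.not_mem_piece_of_lt h h' hr
    · exact M.not_mem_piece_of_lt h hr
  · simp

end EHModel

/-- The effective peak amplitude `min {A, √ρmax / |h|}`. -/
def peakAmplitude (M : EHModel) (h : ℂ) (A : ℝ) : ℝ := min A (√M.ρmax / ‖h‖)

/-- The noiseless output `x = √ψ(|h s|²)` as a function of the input `s`. -/
def outputSignal (M : EHModel) (h : ℂ) (s : ℝ) : ℝ := √(M.psi (‖h * (s : ℂ)‖ ^ 2))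

/-- The average harvested power `E[ψ(|h s|²)]` for the input law `p`. -/
def avgHarvestedPower (M : EHModel) (h : ℂ) (p : ProbabilityMeasure ℝ) : ℝ :=
  ∫ s, M.psi (‖h * (s : ℂ)‖ ^ 2) ∂(p : Measure ℝ)

/-- Input laws supported in `[0, a]` with average harvested power at least `Preq`. -/
def feasibleInputs (M : EHModel) (h : ℂ) (a Preq : ℝ) : Set (ProbabilityMeasure ℝ) :=
  {p | (p : Measure ℝ) (Set.Icc 0 a)ᶜ = 0 ∧ Preq ≤ avgHarvestedPower M h p}

/-- Mutual information (in nats) of two random variables with joint law `π`. -/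
def mutualInformation {α β : Type*} [MeasurableSpace α] [MeasurableSpace β]
    (π : Measure (α × β)) : ℝ≥0∞ :=
  InformationTheory.klDiv π (π.fst.prod π.snd)

/-- The joint law of `(s, y)`, where `s` has law `p` and `y = √ψ(|h s|²) + n` with
`n ~ N(0, σ²)` independent of `s`. -/
def inputOutputLaw (M : EHModel) (h : ℂ) (σ : ℝ) (p : ProbabilityMeasure ℝ) :
    Measure (ℝ × ℝ) :=
  ((p : Measure ℝ).prod (gaussianReal 0 (Real.toNNReal (σ ^ 2)))).map
    fun z => (z.1, outputSignal M h z.1 + z.2)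

/-- The mutual information `I(s; y)` between channel input and output. -/
def channelMI (M : EHModel) (h : ℂ) (σ : ℝ) (p : ProbabilityMeasure ℝ) : EReal :=
  (mutualInformation (inputOutputLaw M h σ p) : EReal)

open Classical in
/-- Differential entropy `-∫ f log f` (in nats) of a law `ν` on `ℝ` with density `f`: the integral
of the positive part of `-f log f` minus that of its negative part, in the extended reals; it is
`-∞` if `ν` has no density. (The indeterminate `∞ - ∞` cannot occur for a law with bounded
support, as `-f log f ≤ 1 / e`.) -/
def differentialEntropy (ν : Measure ℝ) : EReal :=
  if ν ≪ volume then
    ((∫⁻ t, ENNReal.ofReal (Real.negMulLog (ν.rnDeriv volume t).toReal) : ℝ≥0∞) : EReal)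
      - ((∫⁻ t, ENNReal.ofReal (-Real.negMulLog (ν.rnDeriv volume t).toReal) : ℝ≥0∞) : EReal)
  else ⊥

/-- The differential entropy of `x = √ψ(|h s|²)` when `s` has law `p`. -/
def outputEntropy (M : EHModel) (h : ℂ) (p : ProbabilityMeasure ℝ) : EReal :=
  differentialEntropy ((p : Measure ℝ).map (outputSignal M h))

/-- `J = ½ ln (1 + e^{2 h_x} / (2 π e σ²))`, with `e^{-∞} = 0`. -/
def achievableMI (M : EHModel) (h : ℂ) (σ : ℝ) (p : ProbabilityMeasure ℝ) : EReal :=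
  ((1 / 2 : ℝ) : EReal) *
    ENNReal.log (1 + EReal.exp (2 * outputEntropy M h p) /
      ENNReal.ofReal (2 * Real.pi * Real.exp 1 * σ ^ 2))

/-- The optimal value `I*` of the constrained problem. -/
def maxChannelMI (M : EHModel) (h : ℂ) (σ a Preq : ℝ) : EReal :=
  ⨆ p ∈ feasibleInputs M h a Preq, channelMI M h σ p

/-- The optimal value `J*` of the constrained problem. -/
def maxAchievableMI (M : EHModel) (h : ℂ) (σ a Preq : ℝ) : EReal :=
  ⨆ p ∈ feasibleInputs M h a Preq, achievableMI M h σ p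

end

/-! Given `s`, the output is Gaussian about `x`, so `I = h(x + n) - h(n)` depends only on the law of
`x` (`mutualInformation_additiveNoise`). Hence `I ≥ J` for each input law is the entropy power
inequality with one Gaussian summand; if `h(x) = -∞`, then `J = 0`.

The inequality is proved by transport. Write `x = T X` and `n = σ Z` with `X`, `Z` independent
standard Gaussians and `T` increasing, and let `(X, Z) = (a u - b w, b u + a w)` with `a² + b² = 1`.
For fixed `w` the sum is an increasing function of `u` with slope `a T' + b σ`. Comparing densities
through `log r ≤ r - 1` bounds `h(x + n)` below by an expectation of the log-slope. Concavity of
`log` and `f(T) T' = φ`, where `f` and `φ` are the densities of `x` and `X`, give `h(x + n) ≥ a²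
(h(x) - log a) + b² (h(n) - log b)` (`le_smoothedEntropy_of_rotation`). The best `a` yields the
inequality (`half_log_one_add_exp_le_smoothedEntropy`).

For attainment, laws on `[0, a]` are weakly compact; for continuous `ψ` the power constraint is
closed and the law of `x` depends continuously on that of `s`. Then `h(x + n)` is continuous
(`continuous_smoothedEntropy`), and `J` increases with `h(x)`, a constant minus the divergence from
Lebesgue measure on an interval (`differentialEntropy_eq_sub_klDiv`). That divergence is lower
semicontinuous, being a supremum of continuous functionals (`lowerSemicontinuous_klDiv`). -/

/-! ### Gaussian densities and Gaussian smoothing -/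

/-- The density at `y` of the law of `x + n`, where `x ∼ ν` and `n ∼ N(0, v)` are independent. -/
noncomputable def smoothedDensity (ν : Measure ℝ) (v : ℝ≥0) (y : ℝ) : ℝ :=
  ∫ x, gaussianPDFReal x v y ∂ν

/-- The differential entropy of `x + n`, where `x ∼ ν` and `n ∼ N(0, v)` are independent. -/
noncomputable def smoothedEntropy (ν : Measure ℝ) (v : ℝ≥0) : ℝ :=
  ∫ y, Real.negMulLog (smoothedDensity ν v y)

lemma gaussianPDFReal_le (x : ℝ) (v : ℝ≥0) (y : ℝ) :
    gaussianPDFReal x v y ≤ (√(2 * Real.pi * v))⁻¹ := by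
  rw [gaussianPDFReal]
  refine mul_le_of_le_one_right (by positivity) (Real.exp_le_one_iff.2 ?_)
  exact div_nonpos_of_nonpos_of_nonneg (neg_nonpos.2 (sq_nonneg _)) (by positivity)

lemma measurable_gaussianPDFReal_prod (v : ℝ≥0) :
    Measurable fun p : ℝ × ℝ => gaussianPDFReal p.1 v p.2 :=
  measurable_uncurry_gaussianPDFReal.comp
    (measurable_fst.prodMk (measurable_const.prodMk measurable_snd))

lemma continuous_gaussianPDFReal_left (v : ℝ≥0) (y : ℝ) :
    Continuous fun x => gaussianPDFReal x v y := by
  unfold gaussianPDFReal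
  fun_prop

lemma log_gaussianPDFReal (x : ℝ) {v : ℝ≥0} (hv : v ≠ 0) (y : ℝ) :
    Real.log (gaussianPDFReal x v y)
      = Real.log (√(2 * Real.pi * v))⁻¹ - (y - x) ^ 2 / (2 * v) := by
  have hv' : (0 : ℝ) < v := by positivity
  rw [gaussianPDFReal, Real.log_mul (by positivity) (Real.exp_pos _).ne', Real.log_exp]
  ring

lemma integrable_gaussianPDFReal_left (ν : Measure ℝ) [IsFiniteMeasure ν] (v : ℝ≥0) (y : ℝ) :
    Integrable (fun x => gaussianPDFReal x v y) ν := by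
  refine Integrable.of_bound (continuous_gaussianPDFReal_left v y).aestronglyMeasurable
    (√(2 * Real.pi * v))⁻¹ (ae_of_all _ fun x => ?_)
  rw [Real.norm_of_nonneg (gaussianPDFReal_nonneg _ _ _)]
  exact gaussianPDFReal_le x v y

lemma measurable_smoothedDensity (ν : Measure ℝ) [SFinite ν] (v : ℝ≥0) :
    Measurable (smoothedDensity ν v) := by
  have h : StronglyMeasurable fun p : ℝ × ℝ => gaussianPDFReal p.2 v p.1 :=
    ((measurable_gaussianPDFReal_prod v).comp measurable_swap).stronglyMeasurable
  exact h.integral_prod_right'.measurable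

lemma smoothedDensity_nonneg (ν : Measure ℝ) (v : ℝ≥0) (y : ℝ) : 0 ≤ smoothedDensity ν v y :=
  integral_nonneg fun _ => gaussianPDFReal_nonneg _ _ _

lemma ofReal_smoothedDensity (ν : Measure ℝ) [IsFiniteMeasure ν] (v : ℝ≥0) (y : ℝ) :
    ENNReal.ofReal (smoothedDensity ν v y) = ∫⁻ x, gaussianPDF x v y ∂ν :=
  ofReal_integral_eq_lintegral_ofReal (integrable_gaussianPDFReal_left ν v y)
    (ae_of_all _ fun _ => gaussianPDFReal_nonneg _ _ _)

/-! ### Bounds on the smoothed density, uniform over laws on `[0, B]` -/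

section Bounds

variable {ν : Measure ℝ} [IsProbabilityMeasure ν] {v : ℝ≥0} {B : ℝ}

lemma smoothedDensity_le (ν : Measure ℝ) [IsProbabilityMeasure ν] (v : ℝ≥0) (y : ℝ) :
    smoothedDensity ν v y ≤ (√(2 * Real.pi * v))⁻¹ := by
  calc smoothedDensity ν v y ≤ ∫ _, (√(2 * Real.pi * v))⁻¹ ∂ν :=
        integral_mono (integrable_gaussianPDFReal_left ν v y) (integrable_const _)
          fun x => gaussianPDFReal_le x v y
    _ = _ := by simp

/-- Since `y² ≤ 2 x² + 2 (y - x)²`, doubling the variance absorbs a shift by `x ∈ [0, B]` at the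
cost of a constant factor. -/
lemma smoothedDensity_le_gaussian (hv : v ≠ 0) (hν : ∀ᵐ x ∂ν, x ∈ Set.Icc 0 B) (y : ℝ) :
    smoothedDensity ν v y
      ≤ (√(2 * Real.pi * v))⁻¹ * Real.exp (B ^ 2 / (2 * v)) * Real.exp (-(4 * v : ℝ)⁻¹ * y ^ 2) := by
  have hv' : (0 : ℝ) < v := by positivity
  refine (integral_mono_ae (integrable_gaussianPDFReal_left ν v y) (integrable_const _)
    (g := fun _ => (√(2 * Real.pi * v))⁻¹ * Real.exp (B ^ 2 / (2 * v))
      * Real.exp (-(4 * v : ℝ)⁻¹ * y ^ 2)) ?_).trans (by simp)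
  filter_upwards [hν] with x hx
  rw [gaussianPDFReal, mul_assoc _ (Real.exp _), ← Real.exp_add]
  refine mul_le_mul_of_nonneg_left (Real.exp_le_exp.2 ?_) (by positivity)
  have h : B ^ 2 / (2 * v) + -(4 * v : ℝ)⁻¹ * y ^ 2 - -(y - x) ^ 2 / (2 * v)
      = (2 * B ^ 2 - y ^ 2 + 2 * (y - x) ^ 2) / (4 * v) := by field_simp; ring
  have : 0 ≤ (2 * B ^ 2 - y ^ 2 + 2 * (y - x) ^ 2) / (4 * v) := by
    refine div_nonneg ?_ (by positivity)
    nlinarith [sq_nonneg (y - 2 * x), mul_nonneg hx.1 (sub_nonneg.2 hx.2), hx.1, hx.2,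
      mul_nonneg (sub_nonneg.2 hx.2) (sub_nonneg.2 hx.2)]
  linarith

lemma le_smoothedDensity (hv : v ≠ 0) (hν : ∀ᵐ x ∂ν, x ∈ Set.Icc 0 B) (y : ℝ) :
    (√(2 * Real.pi * v))⁻¹ * Real.exp (-((y ^ 2 + B ^ 2) / v)) ≤ smoothedDensity ν v y := by
  have hv' : (0 : ℝ) < v := by positivity
  refine (show _ = _ by simp).trans_le (integral_mono_ae (integrable_const _)
    (integrable_gaussianPDFReal_left ν v y) (f := fun _ => (√(2 * Real.pi * v))⁻¹
      * Real.exp (-((y ^ 2 + B ^ 2) / v))) ?_)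
  filter_upwards [hν] with x hx
  rw [gaussianPDFReal]
  refine mul_le_mul_of_nonneg_left (Real.exp_le_exp.2 ?_) (by positivity)
  have h : -(y - x) ^ 2 / (2 * v) - -((y ^ 2 + B ^ 2) / v)
      = (2 * y ^ 2 + 2 * B ^ 2 - (y - x) ^ 2) / (2 * v) := by field_simp; ring
  have : 0 ≤ (2 * y ^ 2 + 2 * B ^ 2 - (y - x) ^ 2) / (2 * v) := by
    refine div_nonneg ?_ (by positivity)
    nlinarith [sq_nonneg (y + x), mul_nonneg hx.1 (sub_nonneg.2 hx.2), hx.1, hx.2,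
      mul_nonneg (sub_nonneg.2 hx.2) (sub_nonneg.2 hx.2)]
  linarith

lemma smoothedDensity_pos (hv : v ≠ 0) (hν : ∀ᵐ x ∂ν, x ∈ Set.Icc 0 B) (y : ℝ) :
    0 < smoothedDensity ν v y := by
  have hv' : (0 : ℝ) < v := by positivity
  exact lt_of_lt_of_le (by positivity) (le_smoothedDensity hv hν y)

lemma abs_log_smoothedDensity_le (hv : v ≠ 0) (hν : ∀ᵐ x ∂ν, x ∈ Set.Icc 0 B) (y : ℝ) :
    |Real.log (smoothedDensity ν v y)|
      ≤ |Real.log (√(2 * Real.pi * v))⁻¹| + (y ^ 2 + B ^ 2) / v := by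
  have hv' : (0 : ℝ) < v := by positivity
  have hpos : 0 < (√(2 * Real.pi * v))⁻¹ := by positivity
  have h1 := Real.log_le_log (smoothedDensity_pos hv hν y) (smoothedDensity_le ν v y)
  have h2 := Real.log_le_log (by positivity) (le_smoothedDensity hv hν y)
  rw [Real.log_mul hpos.ne' (Real.exp_pos _).ne', Real.log_exp] at h2
  have h3 : 0 ≤ (y ^ 2 + B ^ 2) / v := by positivity
  rw [abs_le]
  constructor
  · linarith [neg_abs_le (Real.log (√(2 * Real.pi * v))⁻¹)]
  · linarith [le_abs_self (Real.log (√(2 * Real.pi * v))⁻¹)]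

/-- An integrable bound for `negMulLog` of the smoothed density that is uniform in the law on
`[0, B]`. -/
noncomputable def smoothedEntropyBound (v : ℝ≥0) (B y : ℝ) : ℝ :=
  ((√(2 * Real.pi * v))⁻¹ * Real.exp (B ^ 2 / (2 * v)) * Real.exp (-(4 * v : ℝ)⁻¹ * y ^ 2))
    * (|Real.log (√(2 * Real.pi * v))⁻¹| + (y ^ 2 + B ^ 2) / v)

lemma integrable_smoothedEntropyBound (hv : v ≠ 0) (B : ℝ) :
    Integrable (smoothedEntropyBound v B) := by
  have hv' : (0 : ℝ) < v := by positivity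
  have hb : (0 : ℝ) < (4 * v : ℝ)⁻¹ := by positivity
  have h0 := integrable_exp_neg_mul_sq hb
  have h2 : Integrable fun y : ℝ => y ^ 2 * Real.exp (-(4 * v : ℝ)⁻¹ * y ^ 2) := by
    simpa using integrable_rpow_mul_exp_neg_mul_sq hb (s := 2) (by norm_num)
  refine ((h0.const_mul ((√(2 * Real.pi * v))⁻¹ * Real.exp (B ^ 2 / (2 * v))
      * (|Real.log (√(2 * Real.pi * v))⁻¹| + B ^ 2 / v))).add
    (h2.const_mul ((√(2 * Real.pi * v))⁻¹ * Real.exp (B ^ 2 / (2 * v)) / v))).congr ?_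
  refine ae_of_all _ fun y => ?_
  simp only [Pi.add_apply, smoothedEntropyBound]
  field_simp
  ring

lemma abs_negMulLog_smoothedDensity_le (hv : v ≠ 0) (hν : ∀ᵐ x ∂ν, x ∈ Set.Icc 0 B) (y : ℝ) :
    |Real.negMulLog (smoothedDensity ν v y)| ≤ smoothedEntropyBound v B y := by
  rw [Real.negMulLog, abs_mul, abs_neg, abs_of_nonneg (smoothedDensity_nonneg ν v y)]
  exact mul_le_mul (smoothedDensity_le_gaussian hv hν y) (abs_log_smoothedDensity_le hv hν y)
    (abs_nonneg _) (by positivity)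

end Bounds

/-! ### The law of signal plus noise -/

lemma lintegral_add_gaussian (p : Measure ℝ) [IsProbabilityMeasure p] {v : ℝ≥0} (hv : v ≠ 0)
    {X : ℝ → ℝ} (hX : Measurable X) {F : ℝ × ℝ → ℝ≥0∞} (hF : Measurable F) :
    ∫⁻ z, F (z.1, X z.1 + z.2) ∂(p.prod (gaussianReal 0 v))
      = ∫⁻ s, (∫⁻ y, gaussianPDF (X s) v y * F (s, y)) ∂p := by
  rw [lintegral_prod _ (by fun_prop)]
  refine lintegral_congr fun s => ?_
  have hFs : Measurable fun y => F (s, y) := hF.comp measurable_prodMk_left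
  rw [← lintegral_map (f := fun y => F (s, y)) (g := fun n => X s + n) hFs (by fun_prop),
    gaussianReal_map_const_add, zero_add, gaussianReal_of_var_ne_zero _ hv,
    lintegral_withDensity_eq_lintegral_mul _ (measurable_gaussianPDF _ _) hFs]
  rfl

/-- The map `X` is left general because two are needed: the channel map applied to the input, and
the transport map applied to a standard Gaussian. -/
lemma map_add_gaussian (ν : Measure ℝ) [IsProbabilityMeasure ν] {v : ℝ≥0} (hv : v ≠ 0)
    {X : ℝ → ℝ} (hX : Measurable X) :
    (ν.prod (gaussianReal 0 v)).map (fun z => X z.1 + z.2)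
      = volume.withDensity fun y => ENNReal.ofReal (smoothedDensity (ν.map X) v y) := by
  have : IsProbabilityMeasure (ν.map X) := Measure.isProbabilityMeasure_map hX.aemeasurable
  refine Measure.ext_of_lintegral _ fun F hF => ?_
  have hm : Measurable fun p : ℝ × ℝ => gaussianPDF p.1 v p.2 :=
    (measurable_gaussianPDFReal_prod v).ennreal_ofReal
  have hmF : Measurable (Function.uncurry fun x y => gaussianPDF (X x) v y * F y) :=
    (hm.comp ((hX.comp measurable_fst).prodMk measurable_snd)).mul (hF.comp measurable_snd)
  have h1 : ∫⁻ y, F y ∂((ν.prod (gaussianReal 0 v)).map (fun z => X z.1 + z.2))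
      = ∫⁻ s, (∫⁻ y, gaussianPDF (X s) v y * F y) ∂ν := by
    rw [lintegral_map hF (by fun_prop)]
    exact lintegral_add_gaussian ν hv hX (F := fun z => F z.2) (hF.comp measurable_snd)
  have h2 : ∀ y, ∫⁻ s, gaussianPDF (X s) v y * F y ∂ν
      = ENNReal.ofReal (smoothedDensity (ν.map X) v y) * F y := fun y => by
    have hy : Measurable fun x => gaussianPDF x v y :=
      (continuous_gaussianPDFReal_left v y).measurable.ennreal_ofReal
    have hyX : Measurable fun s => gaussianPDF (X s) v y := hy.comp hX
    rw [ofReal_smoothedDensity, lintegral_map hy hX, lintegral_mul_const _ hyX]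
  have h3 := lintegral_lintegral_swap (μ := ν) (ν := volume)
    (f := fun x y => gaussianPDF (X x) v y * F y) hmF.aemeasurable
  exact h1.trans (h3.trans ((lintegral_congr h2).trans
    (lintegral_withDensity_eq_lintegral_mul _
      (measurable_smoothedDensity _ v).ennreal_ofReal hF).symm))

lemma integral_log_smoothedDensity (ν : Measure ℝ) [IsProbabilityMeasure ν] {v : ℝ≥0}
    (hv : v ≠ 0) {X : ℝ → ℝ} (hX : Measurable X) :
    ∫ z, Real.log (smoothedDensity (ν.map X) v (X z.1 + z.2)) ∂(ν.prod (gaussianReal 0 v))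
      = -smoothedEntropy (ν.map X) v := by
  have : IsProbabilityMeasure (ν.map X) := Measure.isProbabilityMeasure_map hX.aemeasurable
  have hq := measurable_smoothedDensity (ν.map X) v
  rw [← integral_map (φ := fun z : ℝ × ℝ => X z.1 + z.2)
      (f := fun y => Real.log (smoothedDensity (ν.map X) v y)) (by fun_prop)
      hq.log.aestronglyMeasurable,
    map_add_gaussian ν hv hX, integral_withDensity_eq_integral_toReal_smul
      hq.ennreal_ofReal (ae_of_all _ fun _ => ENNReal.ofReal_lt_top), smoothedEntropy,
    ← integral_neg]
  refine integral_congr_ae (ae_of_all _ fun y => ?_)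
  simp [ENNReal.toReal_ofReal (smoothedDensity_nonneg _ v y), Real.negMulLog]

lemma integrable_log_smoothedDensity (ν : Measure ℝ) [IsProbabilityMeasure ν] {v : ℝ≥0}
    (hv : v ≠ 0) {X : ℝ → ℝ} (hX : Measurable X) {B : ℝ}
    (hν : ∀ᵐ x ∂(ν.map X), x ∈ Set.Icc 0 B) :
    Integrable (fun z : ℝ × ℝ => Real.log (smoothedDensity (ν.map X) v (X z.1 + z.2)))
      (ν.prod (gaussianReal 0 v)) := by
  have : IsProbabilityMeasure (ν.map X) := Measure.isProbabilityMeasure_map hX.aemeasurable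
  have hq := measurable_smoothedDensity (ν.map X) v
  have h : Integrable (fun y => Real.log (smoothedDensity (ν.map X) v y))
      ((ν.prod (gaussianReal 0 v)).map fun z : ℝ × ℝ => X z.1 + z.2) := by
    rw [map_add_gaussian ν hv hX, integrable_withDensity_iff_integrable_smul'
      hq.ennreal_ofReal (ae_of_all _ fun _ => ENNReal.ofReal_lt_top)]
    refine (integrable_smoothedEntropyBound hv B).mono' (by fun_prop) (ae_of_all _ fun y => ?_)
    refine le_trans (le_of_eq ?_) (abs_negMulLog_smoothedDensity_le hv hν y)
    simp [ENNReal.toReal_ofReal (smoothedDensity_nonneg _ v y), Real.negMulLog]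
  exact h.comp_measurable (by fun_prop)

/-! ### Monotone transport from the standard Gaussian law -/

open Filter Topology in
lemma continuous_cdf (ν : Measure ℝ) [IsProbabilityMeasure ν] (h0 : ∀ x, ν {x} = 0) :
    Continuous (cdf ν) := by
  refine continuous_iff_continuousAt.2 fun x => ?_
  have h := (cdf ν).measure_singleton x
  rw [measure_cdf, h0, eq_comm, ENNReal.ofReal_eq_zero] at h
  have h1 := (monotone_cdf ν).leftLim_le (le_refl x)
  have h2 : Function.leftLim (cdf ν) x = cdf ν x := le_antisymm h1 (by linarith)
  rw [(monotone_cdf ν).continuousAt_iff_leftLim_eq_rightLim, h2, (cdf ν).rightLim_eq]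

lemma gaussianReal_pos_of_volume_pos {s : Set ℝ} (hs : volume s ≠ 0) :
    0 < gaussianReal 0 1 s :=
  pos_iff_ne_zero.2 fun h => hs (gaussianReal_absolutelyContinuous' 0 one_ne_zero h)

lemma cdf_gaussianReal_pos (x : ℝ) : 0 < cdf (gaussianReal 0 1) x := by
  rw [cdf_eq_real]
  exact ENNReal.toReal_pos (gaussianReal_pos_of_volume_pos (by simp)).ne' (measure_ne_top _ _)

lemma strictMono_cdf_gaussianReal : StrictMono (cdf (gaussianReal 0 1)) := by
  intro x y hxy
  have h : 0 < (gaussianReal 0 1).real (Set.Ioc x y) :=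
    ENNReal.toReal_pos (gaussianReal_pos_of_volume_pos (by simp [hxy])).ne' (measure_ne_top _ _)
  rw [cdf_eq_real, cdf_eq_real, ← Set.Iic_union_Ioc_eq_Iic hxy.le,
    measureReal_union (Set.Iic_disjoint_Ioc le_rfl) measurableSet_Ioc]
  linarith

lemma cdf_gaussianReal_lt_one (x : ℝ) : cdf (gaussianReal 0 1) x < 1 :=
  (strictMono_cdf_gaussianReal (lt_add_one x)).trans_le (cdf_le_one _ _)

lemma continuous_cdf_gaussianReal : Continuous (cdf (gaussianReal 0 1)) :=
  continuous_cdf _ fun _ => gaussianReal_absolutelyContinuous 0 one_ne_zero (by simp)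

/-- Probability integral transform. The endpoints are separate because the Gaussian distribution
function never takes the values `0` and `1`. -/
lemma gaussianReal_cdf_le {u : ℝ} (hu0 : 0 ≤ u) (hu1 : u ≤ 1) :
    gaussianReal 0 1 {x | cdf (gaussianReal 0 1) x ≤ u} = ENNReal.ofReal u := by
  rcases hu0.eq_or_lt with rfl | hu0
  · simp [(cdf_gaussianReal_pos _).not_ge]
  rcases hu1.eq_or_lt with rfl | hu1
  · simp [cdf_le_one]
  obtain ⟨a, ha⟩ := ((tendsto_cdf_atBot (gaussianReal 0 1)).eventually_lt_const hu0).exists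
  obtain ⟨b, hb⟩ := ((tendsto_cdf_atTop (gaussianReal 0 1)).eventually_const_lt hu1).exists
  obtain ⟨x, rfl⟩ := mem_range_of_exists_le_of_exists_ge continuous_cdf_gaussianReal
    ⟨a, ha.le⟩ ⟨b, hb.le⟩
  simp only [strictMono_cdf_gaussianReal.le_iff_le]
  exact (ofReal_cdf _ _).symm

/-- The monotone map that transports the standard Gaussian law to `ν`. -/
noncomputable def gaussianTransport (ν : Measure ℝ) (x : ℝ) : ℝ :=
  sInf {t | cdf (gaussianReal 0 1) x ≤ cdf ν t}

section Transport

variable {ν : Measure ℝ} [IsProbabilityMeasure ν]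

/-- The infimum is attained: its set is nonempty and bounded below because the Gaussian distribution
function lies strictly between `0` and `1`, and closed because `cdf ν` is continuous. -/
lemma gaussianTransport_le_iff (h0 : ∀ x, ν {x} = 0) {x t : ℝ} :
    gaussianTransport ν x ≤ t ↔ cdf (gaussianReal 0 1) x ≤ cdf ν t := by
  have hbdd : BddBelow {t | cdf (gaussianReal 0 1) x ≤ cdf ν t} := by
    obtain ⟨a, ha⟩ := ((tendsto_cdf_atBot ν).eventually_lt_const (cdf_gaussianReal_pos x)).exists
    refine ⟨a, fun t ht => ?_⟩
    by_contra! hta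
    exact absurd (ht.trans (monotone_cdf ν hta.le)) ha.not_ge
  have hne : {t | cdf (gaussianReal 0 1) x ≤ cdf ν t}.Nonempty := by
    obtain ⟨b, hb⟩ :=
      ((tendsto_cdf_atTop ν).eventually_const_lt (cdf_gaussianReal_lt_one x)).exists
    exact ⟨b, hb.le⟩
  have hcl : IsClosed {t | cdf (gaussianReal 0 1) x ≤ cdf ν t} :=
    isClosed_le continuous_const (continuous_cdf ν h0)
  exact ⟨fun h => le_trans (hcl.csInf_mem hne hbdd : _ ≤ _) (monotone_cdf ν h),
    fun h => csInf_le hbdd h⟩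

lemma monotone_gaussianTransport (h0 : ∀ x, ν {x} = 0) : Monotone (gaussianTransport ν) :=
  fun _ _ hxy => (gaussianTransport_le_iff h0).2
    ((strictMono_cdf_gaussianReal.monotone hxy).trans ((gaussianTransport_le_iff h0).1 le_rfl))

/-- Attainment of the infimum gives one inequality. To the left of the infimum `cdf ν` is smaller
than the target value, and continuity gives the other. -/
lemma cdf_gaussianTransport (h0 : ∀ x, ν {x} = 0) (x : ℝ) :
    cdf ν (gaussianTransport ν x) = cdf (gaussianReal 0 1) x := by
  refine le_antisymm ?_ ((gaussianTransport_le_iff h0).1 le_rfl)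
  refine ContinuousWithinAt.closure_le (s := Set.Iio (gaussianTransport ν x)) (by simp)
    (continuous_cdf ν h0).continuousWithinAt continuousWithinAt_const fun t ht => ?_
  by_contra! h
  exact absurd ((gaussianTransport_le_iff h0).2 h.le) (not_le.2 ht)

lemma map_gaussianTransport (h0 : ∀ x, ν {x} = 0) :
    (gaussianReal 0 1).map (gaussianTransport ν) = ν := by
  have hm := (monotone_gaussianTransport h0).measurable
  have := Measure.isProbabilityMeasure_map (μ := gaussianReal 0 1) hm.aemeasurable
  refine Measure.ext_of_Iic _ _ fun t => ?_
  rw [Measure.map_apply hm measurableSet_Iic, ← ofReal_cdf,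
    ← gaussianReal_cdf_le (cdf_nonneg ν t) (cdf_le_one ν t)]
  congr 1
  ext x
  exact gaussianTransport_le_iff h0

/-- The Monge–Ampère equation for the monotone transport from the standard Gaussian law. -/
lemma ae_rnDeriv_mul_deriv_gaussianTransport (hν : ν ≪ volume) :
    ∀ᵐ x ∂(gaussianReal 0 1),
      DifferentiableAt ℝ (gaussianTransport ν) x ∧
      (ν.rnDeriv volume (gaussianTransport ν x)).toReal * deriv (gaussianTransport ν) x
        = gaussianPDFReal 0 1 x := by
  have h0 : ∀ x, ν {x} = 0 := fun x => hν (by simp)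
  have hγ := gaussianReal_absolutelyContinuous 0 (one_ne_zero (α := ℝ≥0))
  have h1 : ∀ᵐ t, HasDerivAt (cdf ν) (ν.rnDeriv volume t).toReal t := by
    have := (cdf ν).ae_hasDerivAt
    rwa [measure_cdf] at this
  -- The exceptional set in `h1` is Lebesgue-null, hence `ν`-null, so its preimage under the
  -- transport is Gaussian-null.
  have h2 : ∀ᵐ x ∂(gaussianReal 0 1), HasDerivAt (cdf ν)
      (ν.rnDeriv volume (gaussianTransport ν x)).toReal (gaussianTransport ν x) := by
    have h := hν.ae_le h1
    rw [← map_gaussianTransport h0] at h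
    have h' := ae_of_ae_map (monotone_gaussianTransport h0).measurable.aemeasurable h
    rwa [map_gaussianTransport h0] at h'
  have h3 : ∀ᵐ x, HasDerivAt (cdf (gaussianReal 0 1)) (gaussianPDFReal 0 1 x) x := by
    have := (cdf (gaussianReal 0 1)).ae_hasDerivAt
    rw [measure_cdf] at this
    filter_upwards [this, rnDeriv_gaussianReal 0 1] with x hx hx'
    rwa [hx', toReal_gaussianPDF] at hx
  filter_upwards [h2, hγ.ae_le h3,
    hγ.ae_le (monotone_gaussianTransport h0).ae_differentiableAt] with x hx2 hx3 hx4
  refine ⟨hx4, ?_⟩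
  have h := hx2.comp x hx4.hasDerivAt
  rw [show cdf ν ∘ gaussianTransport ν = cdf (gaussianReal 0 1) from
    funext (cdf_gaussianTransport h0)] at h
  exact h.unique hx3

end Transport

/-! ### Monotone change of variables and Gaussian rotations -/

/-- A monotone function is differentiable almost everywhere, and the change of variables is exact on
that set by injectivity. Only an inequality survives since the image may miss part of the line. -/
lemma lintegral_deriv_mul_comp_le {S : ℝ → ℝ} (hS : StrictMono S) (q : ℝ → ℝ≥0∞) :
    ∫⁻ u, ENNReal.ofReal (deriv S u) * q (S u) ≤ ∫⁻ y, q y := by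
  have hs := measurableSet_of_differentiableAt ℝ S
  calc ∫⁻ u, ENNReal.ofReal (deriv S u) * q (S u)
      = ∫⁻ u in {u | DifferentiableAt ℝ S u}, ENNReal.ofReal |deriv S u| * q (S u) := by
        have h : volume.restrict {u | DifferentiableAt ℝ S u} = volume :=
          Measure.restrict_eq_self_of_ae_mem hS.monotone.ae_differentiableAt
        simp only [h, abs_of_nonneg hS.monotone.deriv_nonneg]
    _ = ∫⁻ y in S '' {u | DifferentiableAt ℝ S u}, q y :=
        (lintegral_image_eq_lintegral_abs_deriv_mul hs
          (fun u hu => DifferentiableAt.hasDerivAt hu |>.hasDerivWithinAt)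
          hS.injective.injOn q).symm
    _ ≤ _ := setLIntegral_le_lintegral _ _

lemma lintegral_monotone_add_linear_le {T : ℝ → ℝ} (hT : Monotone T) {a b σ : ℝ} (ha : 0 < a)
    (hb : 0 < b) (hσ : 0 < σ) (w : ℝ) (q : ℝ → ℝ≥0∞) :
    ∫⁻ u, ENNReal.ofReal (a * deriv T (a * u - b * w) + b * σ)
        * q (T (a * u - b * w) + σ * (b * u + a * w)) ≤ ∫⁻ y, q y := by
  set S : ℝ → ℝ := fun u => T (a * u - b * w) + σ * (b * u + a * w) with hS_def
  have hS : StrictMono S := fun x y hxy => by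
    refine add_lt_add_of_le_of_lt (hT (by nlinarith)) ?_
    have := mul_lt_mul_of_pos_left hxy (mul_pos hσ hb)
    nlinarith
  refine le_trans (le_of_eq (lintegral_congr_ae ?_)) (lintegral_deriv_mul_comp_le hS q)
  filter_upwards [hS.monotone.ae_differentiableAt] with u hu
  -- `T` is recovered from `S` by subtracting a linear term and an affine change of variable, so it
  -- is differentiable wherever needed.
  have hT' : DifferentiableAt ℝ T (a * u - b * w) := by
    have h1 : T = (fun u => S u - σ * (b * u + a * w)) ∘ fun x => (x + b * w) / a := by
      ext x
      have : a * ((x + b * w) / a) - b * w = x := by field_simp; ring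
      simp only [hS_def, Function.comp_apply, this]
      ring
    rw [h1]
    refine DifferentiableAt.comp _ ?_ (by fun_prop)
    rw [show (a * u - b * w + b * w) / a = u by field_simp; ring]
    exact hu.sub (by fun_prop)
  have h2 : HasDerivAt S (deriv T (a * u - b * w) * a + σ * b) u := by
    refine HasDerivAt.add ?_ ?_
    · refine HasDerivAt.comp u (h₂ := T) hT'.hasDerivAt ?_
      simpa using ((hasDerivAt_id u).const_mul a).sub_const (b * w)
    · simpa using (((hasDerivAt_id u).const_mul b).add_const (a * w)).const_mul σ
  rw [h2.deriv, mul_comm _ a, mul_comm σ b]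

lemma map_rotation_gaussianReal (θ : ℝ) :
    ((gaussianReal 0 1).prod (gaussianReal 0 1)).map
      (fun z : ℝ × ℝ => (Real.cos θ * z.1 - Real.sin θ * z.2, Real.sin θ * z.1 + Real.cos θ * z.2))
      = (gaussianReal 0 1).prod (gaussianReal 0 1) := by
  have h := IsGaussian.map_rotation_eq_self (μ := gaussianReal 0 1) (by simp) (-θ)
  convert h using 2
  ext z <;> simp [ContinuousLinearMap.rotation_apply, sub_eq_add_neg]

lemma log_gaussianPDFReal_std (x : ℝ) :
    Real.log (gaussianPDFReal 0 1 x) = -(Real.log (2 * Real.pi) / 2) - x ^ 2 / 2 := by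
  rw [log_gaussianPDFReal 0 one_ne_zero]
  rw [Real.log_inv, Real.log_sqrt (by positivity)]
  simp

lemma integrable_log_gaussianPDFReal_std :
    Integrable (fun x => Real.log (gaussianPDFReal 0 1 x)) (gaussianReal 0 1) := by
  simp only [log_gaussianPDFReal_std]
  exact (integrable_const _).sub ((memLp_id_gaussianReal 2).integrable_sq.div_const 2)

lemma integral_log_gaussianPDFReal_std :
    ∫ x, Real.log (gaussianPDFReal 0 1 x) ∂(gaussianReal 0 1)
      = -(Real.log (2 * Real.pi) / 2) - 1 / 2 := by
  have h : ∫ x, x ^ 2 ∂(gaussianReal 0 1) = 1 := by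
    have h1 := variance_fun_id_gaussianReal (μ := 0) (v := 1)
    rw [variance_eq_integral (by fun_prop)] at h1
    simpa using h1
  simp only [log_gaussianPDFReal_std]
  have h2 : Integrable (fun x : ℝ => x ^ 2 / 2) (gaussianReal 0 1) :=
    (memLp_id_gaussianReal 2).integrable_sq.div_const 2
  rw [integral_sub (integrable_const _) h2, integral_div, h]
  simp

/-! ### The entropy power inequality with a Gaussian summand -/

section EntropyPower

variable {ν : Measure ℝ} [IsProbabilityMeasure ν] {B σ : ℝ}

lemma gaussianReal_map_mul_std (σ : ℝ) :
    (gaussianReal 0 1).map (fun z => σ * z) = gaussianReal 0 (Real.toNNReal (σ ^ 2)) := by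
  rw [gaussianReal_map_const_mul]
  congr 1
  · simp
  · ext; simp [Real.coe_toNNReal _ (sq_nonneg σ)]

lemma map_prod_gaussianReal_mul_std (σ : ℝ) :
    ((gaussianReal 0 1).prod (gaussianReal 0 1)).map (fun z : ℝ × ℝ => (z.1, σ * z.2))
      = (gaussianReal 0 1).prod (gaussianReal 0 (Real.toNNReal (σ ^ 2))) := by
  rw [← gaussianReal_map_mul_std σ]
  have := Measure.map_prod_map (gaussianReal 0 1) (gaussianReal 0 1) (f := id)
    (g := fun z => σ * z) measurable_id (by fun_prop)
  rw [Measure.map_id] at this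
  exact this.symm

/-- Concavity of `log` at `a T' + b σ = a² (T' / a) + b² (σ / b)`; the Monge–Ampère equation then
replaces `log T'` by a difference of log-densities. -/
lemma ae_log_ratio_le (hν : ν ≪ volume) {a b : ℝ} (ha : 0 < a) (hb : 0 < b)
    (hab : a ^ 2 + b ^ 2 = 1) (hσ : 0 < σ) :
    ∀ᵐ x ∂(gaussianReal 0 1),
      a ^ 2 * (Real.log (gaussianPDFReal 0 1 x)
          - Real.log (ν.rnDeriv volume (gaussianTransport ν x)).toReal - Real.log a)
        + b ^ 2 * (Real.log σ - Real.log b)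
      ≤ Real.log (a * deriv (gaussianTransport ν) x + b * σ) := by
  filter_upwards [ae_rnDeriv_mul_deriv_gaussianTransport hν] with x ⟨_, hx⟩
  have hφ := gaussianPDFReal_pos 0 1 x one_ne_zero
  rw [← hx] at hφ ⊢
  have hf : 0 < (ν.rnDeriv volume (gaussianTransport ν x)).toReal :=
    lt_of_le_of_ne ENNReal.toReal_nonneg fun h => by simp [← h] at hφ
  have hT : 0 < deriv (gaussianTransport ν) x := pos_of_mul_pos_right hφ hf.le
  rw [Real.log_mul hf.ne' hT.ne']
  have h := strictConcaveOn_log_Ioi.concaveOn.2 (x := deriv (gaussianTransport ν) x / a)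
    (y := σ / b) (by simp; positivity) (by simp; positivity) (sq_nonneg a) (sq_nonneg b) hab
  rw [Real.log_div hT.ne' ha.ne', Real.log_div hσ.ne' hb.ne'] at h
  simp only [smul_eq_mul] at h
  refine le_trans (le_of_eq (by ring)) (h.trans (le_of_eq ?_))
  congr 1
  field_simp

/-- Entropy inequality for the sum of `x ∼ ν` and an independent Gaussian variable. The variables
`x` and `n` are written as images `T X` and `σ Z` of independent standard Gaussian variables, and
`(X, Z)` as a rotation of another such pair `(u, w)`: for fixed `w` the sum is an increasing
function of `u`. -/
lemma le_smoothedEntropy_of_rotation (hνB : ∀ᵐ x ∂ν, x ∈ Set.Icc 0 B) (hν : ν ≪ volume)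
    (hlog : Integrable (fun t => Real.log (ν.rnDeriv volume t).toReal) ν) {a b : ℝ} (ha : 0 < a)
    (hb : 0 < b) (hab : a ^ 2 + b ^ 2 = 1) (hσ : 0 < σ) :
    a ^ 2 * (-∫ t, Real.log (ν.rnDeriv volume t).toReal ∂ν - Real.log a)
        + b ^ 2 * (Real.log σ + (Real.log (2 * Real.pi) / 2 + 1 / 2) - Real.log b)
      ≤ smoothedEntropy ν (Real.toNNReal (σ ^ 2)) := by
  have h0 : ∀ x, ν {x} = 0 := fun x => hν (by simp)
  set v := Real.toNNReal (σ ^ 2) with hv_def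
  have hv : v ≠ 0 := by simp [hv_def, hσ.ne']
  set γ := gaussianReal 0 1 with hγ
  set T := gaussianTransport ν with hT_def
  have hTmono : Monotone T := monotone_gaussianTransport h0
  have hT := hTmono.measurable
  have hmap : γ.map T = ν := map_gaussianTransport h0
  have hq := measurable_smoothedDensity ν v
  have hrotm : Measurable fun z : ℝ × ℝ => (a * z.1 - b * z.2, b * z.1 + a * z.2) := by fun_prop
  have hrot : MeasurePreserving (fun z : ℝ × ℝ => (a * z.1 - b * z.2, b * z.1 + a * z.2))
      (γ.prod γ) (γ.prod γ) := by
    refine ⟨hrotm, ?_⟩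
    have h := map_rotation_gaussianReal (Real.arccos a)
    rwa [Real.cos_arccos (by linarith) (by nlinarith), Real.sin_arccos,
      show 1 - a ^ 2 = b ^ 2 by linarith, Real.sqrt_sq hb.le] at h
  have hscale : MeasurePreserving (fun z : ℝ × ℝ => (z.1, σ * z.2)) (γ.prod γ)
      (γ.prod (gaussianReal 0 v)) := ⟨by fun_prop, map_prod_gaussianReal_mul_std σ⟩
  have i1 : Integrable (fun z : ℝ × ℝ => Real.log (smoothedDensity ν v (T z.1 + σ * z.2)))
      (γ.prod γ) := by
    have h := integrable_log_smoothedDensity γ hv hT (B := B) (by rwa [hmap])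
    rw [hmap] at h
    exact hscale.integrable_comp_of_integrable h
  have e1 : ∫ z : ℝ × ℝ, Real.log (smoothedDensity ν v (T z.1 + σ * z.2)) ∂(γ.prod γ)
      = -smoothedEntropy ν v := by
    have h := integral_log_smoothedDensity γ hv hT
    rw [hmap, ← hscale.map_eq, integral_map hscale.aemeasurable
      (Measurable.aestronglyMeasurable (by fun_prop))] at h
    exact h
  have i2 : Integrable (fun x => Real.log (gaussianPDFReal 0 1 x)) γ :=
    integrable_log_gaussianPDFReal_std
  have hfm : Measurable fun t => Real.log (ν.rnDeriv volume t).toReal := by fun_prop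
  have i3 : Integrable (fun x => Real.log (ν.rnDeriv volume (T x)).toReal) γ := by
    rw [← hmap] at hlog
    have := hlog.comp_measurable hT
    rwa [hmap] at this
  have e3 : ∫ x, Real.log (ν.rnDeriv volume (T x)).toReal ∂γ
      = ∫ t, Real.log (ν.rnDeriv volume t).toReal ∂ν := by
    have := integral_map (μ := γ) hT.aemeasurable
      (f := fun t => Real.log (ν.rnDeriv volume t).toReal) hfm.aestronglyMeasurable
    rw [hmap] at this
    exact this.symm
  -- The log-density of the sum plus the concavity lower bound for the log-slope, in the coordinates
  -- `(X, Z)`.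
  set K : ℝ × ℝ → ℝ := fun p => Real.log (smoothedDensity ν v (T p.1 + σ * p.2))
      + (a ^ 2 * (Real.log (gaussianPDFReal 0 1 p.1)
          - Real.log (ν.rnDeriv volume (T p.1)).toReal - Real.log a)
        + b ^ 2 * (Real.log σ - Real.log b)) with hK
  have i23 : Integrable (fun x => Real.log (gaussianPDFReal 0 1 x)
      - Real.log (ν.rnDeriv volume (T x)).toReal) γ := i2.sub i3
  have i23' : Integrable (fun x => a ^ 2 * (Real.log (gaussianPDFReal 0 1 x)
      - Real.log (ν.rnDeriv volume (T x)).toReal - Real.log a)) γ :=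
    (i23.sub (integrable_const _)).const_mul _
  have i4 : Integrable (fun x => a ^ 2 * (Real.log (gaussianPDFReal 0 1 x)
          - Real.log (ν.rnDeriv volume (T x)).toReal - Real.log a)
        + b ^ 2 * (Real.log σ - Real.log b)) γ :=
    i23'.add (integrable_const _)
  have iK : Integrable K (γ.prod γ) := i1.add (i4.comp_fst γ)
  have eK : ∫ z, K z ∂(γ.prod γ) = -smoothedEntropy ν v
      + (a ^ 2 * (-(Real.log (2 * Real.pi) / 2) - 1 / 2
          - ∫ t, Real.log (ν.rnDeriv volume t).toReal ∂ν - Real.log a)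
        + b ^ 2 * (Real.log σ - Real.log b)) := by
    rw [hK, integral_add i1 (i4.comp_fst γ), e1,
      integral_fun_fst (μ := γ) (ν := γ) (fun x => a ^ 2 * (Real.log (gaussianPDFReal 0 1 x)
          - Real.log (ν.rnDeriv volume (T x)).toReal - Real.log a)
        + b ^ 2 * (Real.log σ - Real.log b)),
      integral_add i23' (integrable_const _),
      integral_const_mul, integral_sub i23 (integrable_const _), integral_sub i2 i3, e3,
      integral_log_gaussianPDFReal_std]
    simp
  -- For fixed `w`, the density of the sum pulled back to the variable `u`, divided by the Gaussian
  -- density of `u`.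
  set r : ℝ × ℝ → ℝ := fun z => smoothedDensity ν v
      (T (a * z.1 - b * z.2) + σ * (b * z.1 + a * z.2))
      * (a * deriv T (a * z.1 - b * z.2) + b * σ) / gaussianPDFReal 0 1 z.1 with hr
  have hφpos : ∀ x, 0 < gaussianPDFReal 0 1 x := fun x => gaussianPDFReal_pos 0 1 x one_ne_zero
  have hslope : ∀ x, 0 < a * deriv T x + b * σ := fun x =>
    add_pos_of_nonneg_of_pos (mul_nonneg ha.le hTmono.deriv_nonneg) (mul_pos hb hσ)
  have hrpos : ∀ z, 0 < r z := fun z =>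
    div_pos (mul_pos (smoothedDensity_pos hv hνB _) (hslope _)) (hφpos _)
  have hrm : Measurable r := by
    have h1 : Measurable (deriv T) := measurable_deriv T
    have h2 := measurable_gaussianPDFReal 0 1
    fun_prop
  -- With `u` integrated first, the Gaussian density cancels and the monotone change of variables
  -- leaves at most `∫ q = 1`, where `q` is the density of the sum.
  have hr1 : ∫⁻ z, ENNReal.ofReal (r z) ∂(γ.prod γ) ≤ 1 := by
    rw [lintegral_prod_symm' _ (by fun_prop)]
    refine (lintegral_mono (g := fun _ => (1 : ℝ≥0∞)) fun w => ?_).trans (by simp)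
    have hw : Measurable fun u => ENNReal.ofReal (r (u, w)) := by fun_prop
    rw [hγ, gaussianReal_of_var_ne_zero 0 one_ne_zero,
      lintegral_withDensity_eq_lintegral_mul _ (measurable_gaussianPDF _ _) hw]
    have hY : ∫⁻ y, ENNReal.ofReal (smoothedDensity ν v y) = 1 := by
      have h := map_add_gaussian γ hv hT
      have h2 := congrArg (fun m : Measure ℝ => m Set.univ) h
      have : IsProbabilityMeasure ((γ.prod (gaussianReal 0 v)).map fun z : ℝ × ℝ => T z.1 + z.2) :=
        Measure.isProbabilityMeasure_map (by fun_prop)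
      simp only [measure_univ, withDensity_apply _ MeasurableSet.univ, hmap,
        Measure.restrict_univ] at h2
      exact h2.symm
    refine le_trans (le_of_eq (lintegral_congr fun u => ?_))
      ((lintegral_monotone_add_linear_le hTmono ha hb hσ w
        (fun y => ENNReal.ofReal (smoothedDensity ν v y))).trans hY.le)
    rw [Pi.mul_apply, gaussianPDF, ← ENNReal.ofReal_mul (hφpos u).le,
      ← ENNReal.ofReal_mul (hslope _).le]
    congr 1
    simp only [hr]
    have := (hφpos u).ne'
    field_simp
  have ir : Integrable r (γ.prod γ) := by
    refine ⟨hrm.aestronglyMeasurable, ?_⟩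
    rw [hasFiniteIntegral_iff_ofReal (ae_of_all _ fun z => (hrpos z).le)]
    exact hr1.trans_lt ENNReal.one_lt_top
  have er : ∫ z, r z ∂(γ.prod γ) ≤ 1 := by
    rw [integral_eq_lintegral_of_nonneg_ae (ae_of_all _ fun z => (hrpos z).le)
      hrm.aestronglyMeasurable]
    exact ENNReal.toReal_le_of_le_ofReal zero_le_one (by simpa using hr1)
  have hae : ∀ᵐ z ∂(γ.prod γ), K (a * z.1 - b * z.2, b * z.1 + a * z.2)
      - Real.log (gaussianPDFReal 0 1 z.1) ≤ r z - 1 := by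
    have h1 := hrot.quasiMeasurePreserving.ae
      (Measure.quasiMeasurePreserving_fst.ae (ae_log_ratio_le hν ha hb hab hσ))
    filter_upwards [h1] with z hz
    refine le_trans ?_ (Real.log_le_sub_one_of_pos (hrpos z))
    rw [hr, Real.log_div (mul_pos (smoothedDensity_pos hv hνB _) (hslope _)).ne' (hφpos _).ne',
      Real.log_mul (smoothedDensity_pos hv hνB _).ne' (hslope _).ne']
    simp only [hK]
    linarith
  have hfin := integral_mono_ae
    ((hrot.integrable_comp_of_integrable iK).sub (i2.comp_fst γ)) (ir.sub (integrable_const 1)) hae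
  have erot : ∫ z : ℝ × ℝ, K (a * z.1 - b * z.2, b * z.1 + a * z.2) ∂(γ.prod γ)
      = ∫ z, K z ∂(γ.prod γ) := by
    have h := integral_map hrot.aemeasurable (f := K) (by rw [hrot.map_eq]; exact iK.1)
    rw [hrot.map_eq] at h
    exact h.symm
  simp only [Pi.sub_apply] at hfin
  rw [integral_sub ir (integrable_const 1), integral_sub
    (hrot.integrable_comp_of_integrable iK) (i2.comp_fst γ)] at hfin
  simp only [Function.comp_apply] at hfin
  rw [erot, eK, integral_fun_fst (μ := γ) (ν := γ) (fun x => Real.log (gaussianPDFReal 0 1 x)),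
    integral_log_gaussianPDFReal_std] at hfin
  simp only [integral_const, probReal_univ, smul_eq_mul, mul_one, one_mul] at hfin
  -- The Gaussian constant occurs once from `u` and `a²` times from `X`; the difference is the
  -- weight `b²` on the noise entropy.
  have hb2 : b ^ 2 = 1 - a ^ 2 := by linarith
  rw [hb2] at hfin ⊢
  linarith

/-- The entropy power inequality for a law on a bounded interval and a Gaussian law. -/
theorem half_log_one_add_exp_le_smoothedEntropy (hνB : ∀ᵐ x ∂ν, x ∈ Set.Icc 0 B)
    (hν : ν ≪ volume) (hlog : Integrable (fun t => Real.log (ν.rnDeriv volume t).toReal) ν)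
    (hσ : 0 < σ) :
    1 / 2 * Real.log (1 + Real.exp (2 * -∫ t, Real.log (ν.rnDeriv volume t).toReal ∂ν)
        / (2 * Real.pi * Real.exp 1 * σ ^ 2))
      ≤ smoothedEntropy ν (Real.toNNReal (σ ^ 2))
        - 1 / 2 * Real.log (2 * Real.pi * Real.exp 1 * σ ^ 2) := by
  set η := -∫ t, Real.log (ν.rnDeriv volume t).toReal ∂ν with hη
  set C := 2 * Real.pi * Real.exp 1 * σ ^ 2 with hC
  have hCpos : 0 < C := by positivity
  set D := Real.exp (2 * η) + C with hD
  have hDpos : 0 < D := by positivity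
  have hlogC : Real.log C = 2 * (Real.log σ + (Real.log (2 * Real.pi) / 2 + 1 / 2)) := by
    rw [hC, Real.log_mul (by positivity) (by positivity), Real.log_mul (by positivity)
      (by positivity), Real.log_exp, Real.log_pow]
    push_cast
    ring
  have ha2 : √(Real.exp (2 * η) / D) ^ 2 = Real.exp (2 * η) / D := Real.sq_sqrt (by positivity)
  have hb2 : √(C / D) ^ 2 = C / D := Real.sq_sqrt (by positivity)
  have hab : √(Real.exp (2 * η) / D) ^ 2 + √(C / D) ^ 2 = 1 := by
    rw [ha2, hb2, ← add_div, div_self hDpos.ne']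
  -- Here `C = exp (2 h(n))`. Weights proportional to the two entropy powers make both brackets of
  -- the rotation bound equal to `log D / 2`.
  have h := le_smoothedEntropy_of_rotation hνB hν hlog (a := √(Real.exp (2 * η) / D))
    (b := √(C / D)) (by positivity) (by positivity) hab hσ
  rw [← hη, Real.log_sqrt (by positivity), Real.log_sqrt (by positivity),
    Real.log_div (by positivity) hDpos.ne', Real.log_div hCpos.ne' hDpos.ne', Real.log_exp,
    show Real.log σ + (Real.log (2 * Real.pi) / 2 + 1 / 2) = Real.log C / 2 by linarith] at h
  rw [show 1 + Real.exp (2 * η) / C = D / C by rw [hD]; field_simp; ring,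
    Real.log_div hDpos.ne' hCpos.ne']
  have h2 : √(Real.exp (2 * η) / D) ^ 2 * (η - (2 * η - Real.log D) / 2)
      + √(C / D) ^ 2 * (Real.log C / 2 - (Real.log C - Real.log D) / 2) = Real.log D / 2 := by
    calc _ = (√(Real.exp (2 * η) / D) ^ 2 + √(C / D) ^ 2) * (Real.log D / 2) := by ring
      _ = _ := by rw [hab, one_mul]
  rw [h2] at h
  linarith

end EntropyPower

/-! ### Mutual information of an additive Gaussian channel -/

section MutualInformation

lemma measurable_gaussianPDFReal_comp {α : Type*} [MeasurableSpace α] (v : ℝ≥0) {X Y : α → ℝ}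
    (hX : Measurable X) (hY : Measurable Y) :
    Measurable fun z => gaussianPDFReal (X z) v (Y z) := by
  unfold gaussianPDFReal
  fun_prop

variable {v : ℝ≥0} {X : ℝ → ℝ}

lemma additiveNoise_fst (p : Measure ℝ) [SFinite p] (v : ℝ≥0) (hX : Measurable X) :
    ((p.prod (gaussianReal 0 v)).map fun z => (z.1, X z.1 + z.2)).fst = p := by
  rw [Measure.fst_map_prodMk (by fun_prop)]
  exact Measure.fst_prod

variable (p : Measure ℝ) [IsProbabilityMeasure p]

lemma additiveNoise_snd (hv : v ≠ 0) (hX : Measurable X) :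
    ((p.prod (gaussianReal 0 v)).map fun z => (z.1, X z.1 + z.2)).snd
      = volume.withDensity fun y => ENNReal.ofReal (smoothedDensity (p.map X) v y) := by
  rw [Measure.snd_map_prodMk (by fun_prop)]
  exact map_add_gaussian p hv hX

lemma additiveNoise_eq_withDensity (hv : v ≠ 0) (hX : Measurable X) {B : ℝ}
    (hB : ∀ᵐ x ∂(p.map X), x ∈ Set.Icc 0 B) :
    (p.prod (gaussianReal 0 v)).map (fun z => (z.1, X z.1 + z.2))
      = (p.prod (volume.withDensity fun y =>
          ENNReal.ofReal (smoothedDensity (p.map X) v y))).withDensity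
        fun z => ENNReal.ofReal
          (gaussianPDFReal (X z.1) v z.2 / smoothedDensity (p.map X) v z.2) := by
  have : IsProbabilityMeasure (p.map X) := Measure.isProbabilityMeasure_map hX.aemeasurable
  have hq := measurable_smoothedDensity (p.map X) v
  have hqpos := smoothedDensity_pos hv hB
  have hg : Measurable fun z : ℝ × ℝ => gaussianPDFReal (X z.1) v z.2 :=
    measurable_gaussianPDFReal_comp v (hX.comp measurable_fst) measurable_snd
  have hD : Measurable fun z : ℝ × ℝ => ENNReal.ofReal
      (gaussianPDFReal (X z.1) v z.2 / smoothedDensity (p.map X) v z.2) := by fun_prop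
  refine Measure.ext_of_lintegral _ fun F hF => ?_
  have h1 : ∫⁻ z, F z ∂((p.prod (gaussianReal 0 v)).map fun z => (z.1, X z.1 + z.2))
      = ∫⁻ s, (∫⁻ y, gaussianPDF (X s) v y * F (s, y)) ∂p := by
    rw [lintegral_map hF (by fun_prop)]
    exact lintegral_add_gaussian p hv hX hF
  rw [h1, lintegral_withDensity_eq_lintegral_mul _ hD hF, lintegral_prod _ (by fun_prop)]
  refine lintegral_congr fun s => ?_
  refine Eq.trans ?_ (lintegral_withDensity_eq_lintegral_mul _ hq.ennreal_ofReal
    ((hD.mul hF).comp (measurable_prodMk_left (x := s)))).symm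
  refine lintegral_congr fun y => ?_
  simp only [Pi.mul_apply, Function.comp_apply]
  rw [← mul_assoc, ← ENNReal.ofReal_mul (hqpos y).le, mul_div_cancel₀ _ (hqpos y).ne']
  rfl

/-- At `y = X s + n` the log-ratio of the joint law to the product of marginals is the log-density
of the noise at `n` minus that of the output at `y`. The first term does not involve `s`, and its
mean is minus the noise entropy. -/
lemma mutualInformation_additiveNoise (hv : v ≠ 0) (hX : Measurable X) {B : ℝ}
    (hB : ∀ᵐ x ∂(p.map X), x ∈ Set.Icc 0 B) :
    mutualInformation ((p.prod (gaussianReal 0 v)).map fun z => (z.1, X z.1 + z.2))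
      = ENNReal.ofReal
        (smoothedEntropy (p.map X) v - 1 / 2 * Real.log (2 * Real.pi * Real.exp 1 * v)) := by
  have hv' : (0 : ℝ) < v := by positivity
  have : IsProbabilityMeasure (p.map X) := Measure.isProbabilityMeasure_map hX.aemeasurable
  have hq := measurable_smoothedDensity (p.map X) v
  have hqpos := smoothedDensity_pos hv hB
  have hg : Measurable fun z : ℝ × ℝ => gaussianPDFReal (X z.1) v z.2 :=
    measurable_gaussianPDFReal_comp v (hX.comp measurable_fst) measurable_snd
  set π := (p.prod (gaussianReal 0 v)).map fun z => (z.1, X z.1 + z.2) with hπ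
  have hπprob : IsProbabilityMeasure π := Measure.isProbabilityMeasure_map (by fun_prop)
  have hfst : IsProbabilityMeasure π.fst := inferInstance
  have hsnd : IsProbabilityMeasure π.snd := inferInstance
  have hdens : π = (π.fst.prod π.snd).withDensity fun z => ENNReal.ofReal
      (gaussianPDFReal (X z.1) v z.2 / smoothedDensity (p.map X) v z.2) := by
    rw [hπ, additiveNoise_fst p v hX, additiveNoise_snd p hv hX]
    exact additiveNoise_eq_withDensity p hv hX hB
  have hac : π ≪ π.fst.prod π.snd := by
    have h := withDensity_absolutelyContinuous (π.fst.prod π.snd) fun z => ENNReal.ofReal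
      (gaussianPDFReal (X z.1) v z.2 / smoothedDensity (p.map X) v z.2)
    rwa [← hdens] at h
  have hllr : llr π (π.fst.prod π.snd) =ᵐ[π] fun z =>
      Real.log (gaussianPDFReal (X z.1) v z.2 / smoothedDensity (p.map X) v z.2) := by
    have h := Measure.rnDeriv_withDensity (π.fst.prod π.snd) (f := fun z => ENNReal.ofReal
      (gaussianPDFReal (X z.1) v z.2 / smoothedDensity (p.map X) v z.2)) (by fun_prop)
    rw [← hdens] at h
    filter_upwards [hac.ae_le h] with z hz
    rw [llr, hz, ENNReal.toReal_ofReal (div_nonneg (gaussianPDFReal_nonneg _ _ _) (hqpos _).le)]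
  have hm : Measurable fun z : ℝ × ℝ => (z.1, X z.1 + z.2) := by fun_prop
  have hlm : Measurable fun z : ℝ × ℝ =>
      Real.log (gaussianPDFReal (X z.1) v z.2 / smoothedDensity (p.map X) v z.2) := by fun_prop
  have hpt : ∀ z : ℝ × ℝ, Real.log (gaussianPDFReal (X z.1) v (X z.1 + z.2)
      / smoothedDensity (p.map X) v (X z.1 + z.2))
      = (Real.log (√(2 * Real.pi * v))⁻¹ - z.2 ^ 2 / (2 * v))
        - Real.log (smoothedDensity (p.map X) v (X z.1 + z.2)) := fun z => by
    rw [Real.log_div (gaussianPDFReal_pos _ _ _ hv).ne' (hqpos _).ne', log_gaussianPDFReal _ hv,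
      add_sub_cancel_left]
  have i1 := integrable_log_smoothedDensity p hv hX hB
  have i2 : Integrable (fun n : ℝ => n ^ 2 / (2 * v)) (gaussianReal 0 v) :=
    (memLp_id_gaussianReal 2).integrable_sq.div_const _
  have i3 : Integrable (fun n : ℝ => Real.log (√(2 * Real.pi * v))⁻¹ - n ^ 2 / (2 * v))
      (gaussianReal 0 v) := (integrable_const _).sub i2
  have i4 : Integrable (llr π (π.fst.prod π.snd)) π := by
    rw [integrable_congr hllr, hπ, integrable_map_measure hlm.aestronglyMeasurable hm.aemeasurable]
    exact ((i3.comp_snd p).sub i1).congr (ae_of_all _ fun z => (hpt z).symm)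
  have e2 : ∫ n, n ^ 2 / (2 * v) ∂(gaussianReal 0 v) = 1 / 2 := by
    have h1 := variance_fun_id_gaussianReal (μ := 0) (v := v)
    rw [variance_eq_integral (by fun_prop)] at h1
    simp only [integral_id_gaussianReal, sub_zero] at h1
    rw [integral_div, h1]
    field_simp
  have e : ∫ z, llr π (π.fst.prod π.snd) z ∂π
      = smoothedEntropy (p.map X) v - 1 / 2 * Real.log (2 * Real.pi * Real.exp 1 * v) := by
    rw [integral_congr_ae hllr, hπ, integral_map hm.aemeasurable hlm.aestronglyMeasurable]
    simp only [hpt]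
    rw [integral_sub (i3.comp_snd p) i1, integral_log_smoothedDensity p hv hX,
      integral_fun_snd (fun n : ℝ => Real.log (√(2 * Real.pi * v))⁻¹ - n ^ 2 / (2 * v)),
      integral_sub (integrable_const _) i2, e2, Real.log_inv, Real.log_sqrt (by positivity),
      show 2 * Real.pi * Real.exp 1 * v = (2 * Real.pi * v) * Real.exp 1 by ring,
      Real.log_mul (by positivity) (Real.exp_pos _).ne', Real.log_exp]
    simp
    ring
  rw [mutualInformation, InformationTheory.klDiv_of_ac_of_integrable hac i4, e]
  simp

end MutualInformation

/-! ### Variational formula for the Kullback–Leibler divergence -/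

section DonskerVaradhan

open InformationTheory

variable {Ω : Type*} [MeasurableSpace Ω]

/-- The functional `φ ↦ ∫ φ dν - ∫ (exp φ - 1) dμ`, whose supremum is the Kullback–Leibler
divergence of `ν` from `μ`. -/
noncomputable def donskerVaradhan (ν μ : Measure Ω) (φ : Ω → ℝ) : ℝ :=
  ∫ x, φ x ∂ν - ∫ x, (Real.exp (φ x) - 1) ∂μ

/-- Fenchel–Young inequality for the conjugate pair `klFun` and `exp - 1`; for `f > 0`, equality
holds at `t = log f`. -/
lemma mul_sub_exp_le_klFun {f : ℝ} (hf : 0 ≤ f) (t : ℝ) :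
    f * t - (Real.exp t - 1) ≤ klFun f := by
  rw [klFun_apply]
  rcases hf.eq_or_lt with rfl | hf
  · simp; exact (Real.exp_pos t).le
  · have h := Real.add_one_le_exp (t - Real.log f)
    rw [Real.exp_sub, Real.exp_log hf, le_div_iff₀ hf] at h
    nlinarith

variable {ν μ : Measure Ω} [IsFiniteMeasure μ]

lemma integrable_of_abs_le [IsFiniteMeasure ν] {φ : Ω → ℝ} (hφ : Measurable φ) {R : ℝ}
    (hR : ∀ x, |φ x| ≤ R) : Integrable φ ν :=
  Integrable.of_bound hφ.aestronglyMeasurable R (ae_of_all _ hR)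

lemma integrable_exp_sub_one_of_abs_le {φ : Ω → ℝ} (hφ : Measurable φ) {R : ℝ}
    (hR : ∀ x, |φ x| ≤ R) : Integrable (fun x => Real.exp (φ x) - 1) μ := by
  refine (integrable_of_abs_le (R := Real.exp R) (by fun_prop) fun x => ?_).sub
    (integrable_const 1)
  rw [Real.abs_exp]
  exact Real.exp_le_exp.2 ((le_abs_self _).trans (hR x))

lemma donskerVaradhan_eq_integral [IsFiniteMeasure ν] (hac : ν ≪ μ) {φ : Ω → ℝ}
    (hφ : Measurable φ) {R : ℝ} (hR : ∀ x, |φ x| ≤ R) :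
    Integrable (fun x => (ν.rnDeriv μ x).toReal * φ x - (Real.exp (φ x) - 1)) μ ∧
    donskerVaradhan ν μ φ = ∫ x, ((ν.rnDeriv μ x).toReal * φ x - (Real.exp (φ x) - 1)) ∂μ := by
  have h1 : Integrable (fun x => (ν.rnDeriv μ x).toReal * φ x) μ :=
    (integrable_rnDeriv_smul_iff hac).2 (integrable_of_abs_le hφ hR)
  have h2 := integrable_exp_sub_one_of_abs_le (μ := μ) hφ hR
  refine ⟨h1.sub h2, ?_⟩
  rw [donskerVaradhan, integral_sub h1 h2, ← integral_rnDeriv_smul hac]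
  rfl

lemma ofReal_donskerVaradhan_le_klDiv [IsFiniteMeasure ν] {φ : Ω → ℝ} (hφ : Measurable φ)
    {R : ℝ} (hR : ∀ x, |φ x| ≤ R) :
    ENNReal.ofReal (donskerVaradhan ν μ φ) ≤ klDiv ν μ := by
  by_cases hac : ν ≪ μ
  · obtain ⟨hi, he⟩ := donskerVaradhan_eq_integral hac hφ hR
    rw [klDiv_eq_lintegral_klFun_of_ac hac, he]
    -- `klFun` of the derivative need not be integrable, so positive parts are taken before passing
    -- to integrals in `[0, ∞]`.
    calc _ ≤ ENNReal.ofReal (∫ x, max ((ν.rnDeriv μ x).toReal * φ x - (Real.exp (φ x) - 1)) 0 ∂μ) :=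
          ENNReal.ofReal_le_ofReal (integral_mono hi hi.pos_part fun x => le_max_left _ _)
      _ = ∫⁻ x, ENNReal.ofReal
            (max ((ν.rnDeriv μ x).toReal * φ x - (Real.exp (φ x) - 1)) 0) ∂μ :=
          ofReal_integral_eq_lintegral_ofReal hi.pos_part (ae_of_all _ fun x => le_max_right _ _)
      _ ≤ _ := lintegral_mono fun x => ENNReal.ofReal_le_ofReal
          (max_le (mul_sub_exp_le_klFun ENNReal.toReal_nonneg _)
            (klFun_nonneg ENNReal.toReal_nonneg))
  · rw [klDiv_of_not_ac hac]
    exact le_top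

/-- The clipping of `t` to the interval `[e⁻ⁿ, eⁿ]`. -/
noncomputable def expClip (n : ℕ) (t : ℝ) : ℝ := min (max t (Real.exp (-n))) (Real.exp n)

lemma expClip_pos (n : ℕ) (t : ℝ) : 0 < expClip n t :=
  lt_min (lt_max_of_lt_right (Real.exp_pos _)) (Real.exp_pos _)

lemma abs_log_expClip_le (n : ℕ) (t : ℝ) : |Real.log (expClip n t)| ≤ n := by
  rw [abs_le, Real.le_log_iff_exp_le (expClip_pos n t), Real.log_le_iff_le_exp (expClip_pos n t)]
  exact ⟨le_min (le_max_right _ _) (Real.exp_le_exp.2 (by linarith [n.cast_nonneg (α := ℝ)])),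
    min_le_right _ _⟩

/-- With `c = expClip n t` the gain is `(t - c) log c + klFun c`. Clipping raises `t` only to a
value `≤ 1` and lowers it only to a value `≥ 1`, so both terms are nonnegative, as Fatou's lemma
requires. -/
lemma expClip_gain_nonneg (n : ℕ) (t : ℝ) :
    0 ≤ t * Real.log (expClip n t) - (expClip n t - 1) := by
  have h : 0 ≤ (t - expClip n t) * Real.log (expClip n t) := by
    rcases lt_trichotomy t (expClip n t) with h | h | h
    · refine mul_nonneg_of_nonpos_of_nonpos (by linarith) ?_
      have : expClip n t ≤ Real.exp (-n) := by
        by_contra! h2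
        have h3 : Real.exp (-n) < max t (Real.exp (-n)) := h2.trans_le (min_le_left _ _)
        have h4 : max t (Real.exp (-n)) = t := by
          rcases max_choice t (Real.exp (-n)) with h5 | h5
          · exact h5
          · exact absurd h5 h3.ne'
        exact absurd ((min_le_left _ _).trans_eq h4 : expClip n t ≤ t) (not_le.2 h)
      exact Real.log_nonpos (expClip_pos n t).le
        (this.trans (Real.exp_le_one_iff.2 (by simp)))
    · rw [← h]; simp
    · refine mul_nonneg (by linarith) (Real.log_nonneg ?_)
      have : Real.exp n ≤ expClip n t := by
        by_contra! h2
        rw [expClip, min_lt_iff] at h2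
        have h3 : max t (Real.exp (-n)) < Real.exp n := h2.resolve_right (lt_irrefl _)
        rw [expClip, min_eq_left h3.le] at h
        exact absurd (le_max_left t _) (not_le.2 h)
      exact (Real.one_le_exp n.cast_nonneg).trans this
  have h2 := klFun_nonneg (expClip_pos n t).le
  rw [klFun_apply] at h2
  linarith

open Filter Topology in
lemma tendsto_expClip_gain {t : ℝ} (ht : 0 ≤ t) :
    Tendsto (fun n => t * Real.log (expClip n t) - (expClip n t - 1)) atTop (𝓝 (klFun t)) := by
  have hn : Tendsto (fun n : ℕ => Real.exp (-(n : ℝ))) atTop (𝓝 0) :=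
    Real.tendsto_exp_atBot.comp (tendsto_neg_atTop_atBot.comp tendsto_natCast_atTop_atTop)
  rcases ht.eq_or_lt with rfl | ht
  · have h : ∀ n : ℕ, expClip n 0 = Real.exp (-n) := fun n => by
      rw [expClip, max_eq_right (Real.exp_pos _).le, min_eq_left]
      exact Real.exp_le_exp.2 (by linarith [n.cast_nonneg (α := ℝ)])
    simp only [h, zero_mul, klFun_zero]
    simpa using (hn.sub_const 1).const_sub 0
  · refine tendsto_const_nhds.congr' ?_
    have hp : Tendsto (fun n : ℕ => Real.exp (n : ℝ)) atTop atTop :=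
      Real.tendsto_exp_atTop.comp tendsto_natCast_atTop_atTop
    filter_upwards [hn.eventually_lt_const ht, hp.eventually_gt_atTop t] with n h1 h2
    rw [expClip, max_eq_left h1.le, min_eq_left h2.le, klFun_apply]
    ring

-- The optimal test function is the log-density; clipping makes it bounded and Fatou's lemma
-- recovers the divergence. Without absolute continuity, large multiples of the indicator of a
-- `μ`-null set charged by `ν` suffice.
open Filter in
lemma exists_measurable_lt_donskerVaradhan [IsFiniteMeasure ν] {c : ℝ≥0∞} (hc : c < klDiv ν μ) :
    ∃ φ : Ω → ℝ, Measurable φ ∧ (∃ R, ∀ x, |φ x| ≤ R) ∧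
      c < ENNReal.ofReal (donskerVaradhan ν μ φ) := by
  by_cases hac : ν ≪ μ
  · have hm : Measurable fun x => (ν.rnDeriv μ x).toReal := by fun_prop
    have hcm : ∀ n, Measurable (expClip n) := fun n => by unfold expClip; fun_prop
    have hgm : ∀ n, Measurable fun x => ENNReal.ofReal ((ν.rnDeriv μ x).toReal
        * Real.log (expClip n (ν.rnDeriv μ x).toReal)
        - (expClip n (ν.rnDeriv μ x).toReal - 1)) := fun n => by fun_prop
    have hfatou := lintegral_liminf_le (μ := μ) hgm (u := atTop)
    have hlim : ∀ x, liminf (fun n => ENNReal.ofReal ((ν.rnDeriv μ x).toReal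
        * Real.log (expClip n (ν.rnDeriv μ x).toReal)
        - (expClip n (ν.rnDeriv μ x).toReal - 1))) atTop
        = ENNReal.ofReal (klFun (ν.rnDeriv μ x).toReal) := fun x =>
      (ENNReal.tendsto_ofReal (tendsto_expClip_gain ENNReal.toReal_nonneg)).liminf_eq
    simp only [hlim] at hfatou
    rw [klDiv_eq_lintegral_klFun_of_ac hac] at hc
    obtain ⟨n, hn⟩ := (eventually_lt_of_lt_liminf (hc.trans_le hfatou)).exists
    have hφm : Measurable fun x => Real.log (expClip n (ν.rnDeriv μ x).toReal) := by fun_prop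
    have hφb : ∀ x, |Real.log (expClip n (ν.rnDeriv μ x).toReal)| ≤ n :=
      fun x => abs_log_expClip_le n _
    refine ⟨_, hφm, ⟨n, hφb⟩, hn.trans_eq ?_⟩
    obtain ⟨hi, he⟩ := donskerVaradhan_eq_integral hac hφm hφb
    simp only [Real.exp_log (expClip_pos _ _)] at hi he
    rw [he, ofReal_integral_eq_lintegral_ofReal hi (ae_of_all _ fun x => expClip_gain_nonneg n _)]
  · obtain ⟨s, hs, hμ, hν⟩ : ∃ s, MeasurableSet s ∧ μ s = 0 ∧ ν s ≠ 0 := by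
      by_contra! h
      exact hac (Measure.AbsolutelyContinuous.mk h)
    have hν' : 0 < ν.real s := ENNReal.toReal_pos hν (measure_ne_top _ _)
    have hc' : c ≠ ∞ := hc.ne_top
    obtain ⟨n, hn⟩ := exists_nat_gt (c.toReal / ν.real s)
    refine ⟨s.indicator fun _ => (n : ℝ), measurable_const.indicator hs, ⟨n, fun x => ?_⟩, ?_⟩
    · by_cases hx : x ∈ s <;> simp [hx]
    · have h1 : ∫ x, (Real.exp (s.indicator (fun _ => (n : ℝ)) x) - 1) ∂μ = 0 := by
        refine integral_eq_zero_of_ae ?_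
        filter_upwards [measure_eq_zero_iff_ae_notMem.1 hμ] with x hx
        simp [hx]
      rw [donskerVaradhan, h1, integral_indicator_const _ hs, sub_zero, smul_eq_mul,
        ENNReal.lt_ofReal_iff_toReal_lt hc', mul_comm]
      exact (div_lt_iff₀ hν').1 hn

end DonskerVaradhan

/-! ### Weak lower semicontinuity of the divergence -/

section Semicontinuity

open InformationTheory BoundedContinuousFunction

variable {μ : Measure ℝ} [IsFiniteMeasure μ]

lemma abs_exp_sub_exp_le {R x y : ℝ} (hx : |x| ≤ R) (hy : |y| ≤ R) :
    |Real.exp x - Real.exp y| ≤ Real.exp R * |x - y| := by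
  wlog h : y ≤ x generalizing x y
  · rw [abs_sub_comm, abs_sub_comm x]
    exact this hy hx (le_of_not_ge h)
  rw [abs_of_nonneg (sub_nonneg.2 (Real.exp_le_exp.2 h)), abs_of_nonneg (sub_nonneg.2 h)]
  have h1 := Real.add_one_le_exp (y - x)
  have h2 : Real.exp y = Real.exp x * Real.exp (y - x) := by rw [← Real.exp_add]; congr 1; ring
  have h3 : Real.exp x ≤ Real.exp R := Real.exp_le_exp.2 ((le_abs_self x).trans hx)
  have h4 := Real.exp_pos x
  nlinarith

/-- Bounded continuous functions are dense in `L¹(ν + μ)`, which controls both integrals at once.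
Truncation at `±R` does not increase the error and keeps `exp` Lipschitz with constant `exp R`. -/
lemma exists_boundedContinuous_lt_donskerVaradhan {ν : Measure ℝ} [IsFiniteMeasure ν] {c : ℝ≥0∞}
    (hc : c < klDiv ν μ) :
    ∃ φ : ℝ →ᵇ ℝ, c < ENNReal.ofReal (donskerVaradhan ν μ φ) := by
  obtain ⟨φ, hφ, ⟨R, hR⟩, hcφ⟩ := exists_measurable_lt_donskerVaradhan hc
  have hR0 : 0 ≤ R := (abs_nonneg _).trans (hR 0)
  rw [ENNReal.lt_ofReal_iff_toReal_lt hc.ne_top] at hcφ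
  set δ := donskerVaradhan ν μ φ - c.toReal with hδ
  have hδ0 : 0 < δ := sub_pos.2 hcφ
  have hφi : Integrable φ (ν + μ) := integrable_of_abs_le hφ hR
  obtain ⟨g, hg, hgi⟩ := hφi.exists_boundedContinuous_integral_sub_le
    (ε := δ / (2 * (1 + Real.exp R))) (by positivity)
  let k : ℝ →ᵇ ℝ := BoundedContinuousFunction.ofNormedAddCommGroup
    (fun x => max (min (g x) R) (-R)) (by fun_prop) R fun x => by
      rw [Real.norm_eq_abs, abs_le]
      exact ⟨le_max_right _ _, max_le (min_le_right _ _) (by linarith)⟩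
  have hkR : ∀ x, |k x| ≤ R := fun x => by
    rw [abs_le]
    exact ⟨le_max_right _ _, max_le (min_le_right _ _) (by linarith)⟩
  have hkm : Measurable k := k.continuous.measurable
  have hkg : ∀ x, |φ x - k x| ≤ ‖φ x - g x‖ := fun x => by
    have h1 : φ x = max (min (φ x) R) (-R) := by
      have := abs_le.1 (hR x)
      rw [min_eq_left this.2, max_eq_left this.1]
    rw [Real.norm_eq_abs]
    calc |φ x - k x| = |max (min (φ x) R) (-R) - max (min (g x) R) (-R)| := by rw [← h1]; rfl
      _ ≤ |min (φ x) R - min (g x) R| := abs_max_sub_max_le_abs _ _ _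
      _ ≤ |φ x - g x| := (abs_min_sub_min_le_max _ _ _ _).trans (by simp)
  refine ⟨k, (ENNReal.lt_ofReal_iff_toReal_lt hc.ne_top).2 ?_⟩
  have hd : Integrable (fun x => ‖φ x - g x‖) (ν + μ) := (hφi.sub hgi).norm
  have hdν := hd.left_of_add_measure
  have hdμ := hd.right_of_add_measure
  rw [integral_add_measure hdν hdμ] at hg
  have h1 : ∫ x, φ x ∂ν - ∫ x, k x ∂ν ≤ ∫ x, ‖φ x - g x‖ ∂ν := by
    have hi1 : Integrable φ ν := integrable_of_abs_le hφ hR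
    have hi2 : Integrable k ν := integrable_of_abs_le hkm hkR
    rw [← integral_sub hi1 hi2]
    exact integral_mono (hi1.sub hi2) hdν fun x => (le_abs_self _).trans (hkg x)
  have h2 : ∫ x, (Real.exp (k x) - 1) ∂μ - ∫ x, (Real.exp (φ x) - 1) ∂μ
      ≤ Real.exp R * ∫ x, ‖φ x - g x‖ ∂μ := by
    have hi1 := integrable_exp_sub_one_of_abs_le (μ := μ) hφ hR
    have hi2 := integrable_exp_sub_one_of_abs_le (μ := μ) hkm hkR
    rw [← integral_sub hi2 hi1, ← integral_const_mul]
    refine integral_mono (hi2.sub hi1) (hdμ.const_mul _) fun x => ?_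
    have h3 := (le_abs_self _).trans (abs_exp_sub_exp_le (hkR x) (hR x))
    rw [abs_sub_comm] at h3
    have h4 := mul_le_mul_of_nonneg_left (hkg x) (Real.exp_pos R).le
    linarith
  have h5 : 0 ≤ ∫ x, ‖φ x - g x‖ ∂ν := integral_nonneg fun x => norm_nonneg _
  have h6 : 0 ≤ ∫ x, ‖φ x - g x‖ ∂μ := integral_nonneg fun x => norm_nonneg _
  have h7 := Real.exp_pos R
  have h8 : ∫ x, ‖φ x - g x‖ ∂ν + Real.exp R * ∫ x, ‖φ x - g x‖ ∂μ ≤ δ / 2 := by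
    have h9 := mul_le_mul_of_nonneg_left hg (by positivity : 0 ≤ 1 + Real.exp R)
    rw [show (1 + Real.exp R) * (δ / (2 * (1 + Real.exp R))) = δ / 2 by field_simp] at h9
    nlinarith [mul_nonneg h7.le h5]
  have h10 : donskerVaradhan ν μ φ - donskerVaradhan ν μ k ≤ δ / 2 := by
    simp only [donskerVaradhan]
    linarith
  linarith

/-- Lower semicontinuity of the Kullback–Leibler divergence for weak convergence. -/
theorem lowerSemicontinuous_klDiv (μ : Measure ℝ) [IsFiniteMeasure μ] :
    LowerSemicontinuous fun ν : ProbabilityMeasure ℝ => klDiv (ν : Measure ℝ) μ := by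
  intro ν c hc
  obtain ⟨φ, hφ⟩ := exists_boundedContinuous_lt_donskerVaradhan hc
  have hcont : Continuous fun ν : ProbabilityMeasure ℝ =>
      ENNReal.ofReal (donskerVaradhan (ν : Measure ℝ) μ φ) :=
    ENNReal.continuous_ofReal.comp
      ((ProbabilityMeasure.continuous_integral_boundedContinuousFunction φ).sub continuous_const)
  filter_upwards [hcont.continuousAt.eventually_const_lt hφ] with ν' h
  exact h.trans_le (ofReal_donskerVaradhan_le_klDiv φ.continuous.measurable fun x =>
    φ.norm_coe_le_norm x)

end Semicontinuity

/-! ### Differential entropy as a divergence from Lebesgue measure -/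

section Entropy

open InformationTheory

/-- The terms are arranged without subtraction so that the identity can be integrated in `[0, ∞]`
even when some integrals are infinite. -/
lemma klFun_add_ofReal_negMulLog {t : ℝ} (ht : 0 ≤ t) :
    ENNReal.ofReal (klFun t) + ENNReal.ofReal (Real.negMulLog t) + ENNReal.ofReal t
      = ENNReal.ofReal (-Real.negMulLog t) + 1 := by
  have hk := klFun_nonneg ht
  have h : klFun t = -Real.negMulLog t + 1 - t := by rw [klFun_apply, Real.negMulLog]; ring
  rcases le_total 0 (Real.negMulLog t) with h0 | h0
  · rw [ENNReal.ofReal_of_nonpos (neg_nonpos.2 h0), ← ENNReal.ofReal_add hk h0,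
      ← ENNReal.ofReal_add (add_nonneg hk h0) ht, zero_add, h,
      show -Real.negMulLog t + 1 - t + Real.negMulLog t + t = 1 by ring, ENNReal.ofReal_one]
  · rw [ENNReal.ofReal_of_nonpos h0, add_zero, ← ENNReal.ofReal_add hk ht, ← ENNReal.ofReal_one,
      ← ENNReal.ofReal_add (neg_nonneg.2 h0) zero_le_one, h]
    congr 1
    ring

variable {ν : Measure ℝ} [IsProbabilityMeasure ν] {B : ℝ}

lemma eq_withDensity_restrict (hνB : ∀ᵐ x ∂ν, x ∈ Set.Icc 0 B) (hac : ν ≪ volume) :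
    ν = (volume.restrict (Set.Icc 0 B)).withDensity (ν.rnDeriv volume) := by
  conv_lhs => rw [← Measure.restrict_eq_self_of_ae_mem hνB, ← Measure.withDensity_rnDeriv_eq ν _ hac]
  exact restrict_withDensity measurableSet_Icc _

lemma absolutelyContinuous_restrict (hνB : ∀ᵐ x ∂ν, x ∈ Set.Icc 0 B) (hac : ν ≪ volume) :
    ν ≪ volume.restrict (Set.Icc 0 B) := by
  have h := withDensity_absolutelyContinuous (volume.restrict (Set.Icc 0 B)) (ν.rnDeriv volume)
  rwa [← eq_withDensity_restrict hνB hac] at h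

lemma rnDeriv_restrict_ae_eq (hνB : ∀ᵐ x ∂ν, x ∈ Set.Icc 0 B) (hac : ν ≪ volume) :
    ν.rnDeriv (volume.restrict (Set.Icc 0 B)) =ᵐ[volume.restrict (Set.Icc 0 B)]
      ν.rnDeriv volume := by
  have h := Measure.rnDeriv_withDensity (volume.restrict (Set.Icc 0 B))
    (Measure.measurable_rnDeriv ν volume)
  rwa [← eq_withDensity_restrict hνB hac] at h

lemma lintegral_comp_rnDeriv_eq_restrict (hνB : ∀ᵐ x ∂ν, x ∈ Set.Icc 0 B) (hac : ν ≪ volume)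
    {g : ℝ≥0∞ → ℝ≥0∞} (hg : g 0 = 0) :
    ∫⁻ t, g (ν.rnDeriv volume t) = ∫⁻ t in Set.Icc 0 B, g (ν.rnDeriv volume t) := by
  rw [← lintegral_add_compl _ (measurableSet_Icc (a := (0 : ℝ)) (b := B))]
  convert add_zero _
  have h1 : ∫⁻ t in (Set.Icc 0 B)ᶜ, ν.rnDeriv volume t = 0 := by
    rw [← withDensity_apply _ measurableSet_Icc.compl, Measure.withDensity_rnDeriv_eq ν _ hac]
    exact mem_ae_iff.1 hνB
  rw [lintegral_eq_zero_iff (Measure.measurable_rnDeriv _ _)] at h1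
  rw [← lintegral_zero]
  refine lintegral_congr_ae ?_
  filter_upwards [h1] with t ht
  rw [ht]
  exact hg

/-- The differential entropy of a law on `[0, B]` in terms of its divergence from the Lebesgue
measure on `[0, B]`. -/
lemma differentialEntropy_eq_sub_klDiv (hB : 0 ≤ B) (hνB : ∀ᵐ x ∂ν, x ∈ Set.Icc 0 B) :
    differentialEntropy ν
      = ((B - 1 : ℝ) : EReal) - (klDiv ν (volume.restrict (Set.Icc 0 B)) : EReal) := by
  rw [differentialEntropy]
  split_ifs with hac
  swap
  · rw [klDiv_of_not_ac fun h => hac (h.trans Measure.restrict_le_self.absolutelyContinuous)]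
    simp
  set f := fun t => (ν.rnDeriv volume t).toReal with hf
  have hfm : Measurable f := by fun_prop
  have hK : klDiv ν (volume.restrict (Set.Icc 0 B))
      = ∫⁻ t in Set.Icc 0 B, ENNReal.ofReal (klFun (f t)) := by
    rw [klDiv_eq_lintegral_klFun_of_ac (absolutelyContinuous_restrict hνB hac)]
    refine lintegral_congr_ae ?_
    filter_upwards [rnDeriv_restrict_ae_eq hνB hac] with t ht
    rw [ht]
  have hnm : Measurable fun t => Real.negMulLog (f t) :=
    Real.continuous_negMulLog.measurable.comp hfm
  rw [lintegral_comp_rnDeriv_eq_restrict hνB hac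
      (g := fun z => ENNReal.ofReal (Real.negMulLog z.toReal)) (by simp),
    lintegral_comp_rnDeriv_eq_restrict hνB hac
      (g := fun z => ENNReal.ofReal (-Real.negMulLog z.toReal)) (by simp)]
  -- On a bounded interval the positive part has finite integral, which excludes `∞ - ∞`.
  have hP : ∫⁻ t in Set.Icc 0 B, ENNReal.ofReal (Real.negMulLog (f t)) ≠ ∞ := by
    refine ne_top_of_le_ne_top ?_ (lintegral_mono (g := fun _ => (1 : ℝ≥0∞)) fun t => ?_)
    · simp
    · refine ENNReal.ofReal_le_one.2 ?_
      have h1 := klFun_nonneg (x := f t) ENNReal.toReal_nonneg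
      have h2 : 0 ≤ f t := ENNReal.toReal_nonneg
      rw [klFun_apply] at h1
      rw [Real.negMulLog]
      linarith
  have hone : ∫⁻ t in Set.Icc 0 B, ENNReal.ofReal (f t) = 1 := by
    have h1 := congrArg (fun m : Measure ℝ => m Set.univ) (eq_withDensity_restrict hνB hac)
    simp only [measure_univ, withDensity_apply _ MeasurableSet.univ, Measure.restrict_univ] at h1
    rw [h1]
    refine lintegral_congr_ae ?_
    filter_upwards [ae_restrict_of_ae (Measure.rnDeriv_lt_top ν volume)] with t ht
    exact ENNReal.ofReal_toReal ht.ne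
  -- The constant `B - 1` is the mass of Lebesgue measure on `[0, B]` minus that of `ν`.
  have hsum : klDiv ν (volume.restrict (Set.Icc 0 B))
      + (∫⁻ t in Set.Icc 0 B, ENNReal.ofReal (Real.negMulLog (f t))) + 1
      = (∫⁻ t in Set.Icc 0 B, ENNReal.ofReal (-Real.negMulLog (f t))) + ENNReal.ofReal B := by
    have h1 := lintegral_congr (μ := volume.restrict (Set.Icc 0 B)) fun t =>
      klFun_add_ofReal_negMulLog (t := f t) ENNReal.toReal_nonneg
    rw [lintegral_add_left (by fun_prop), lintegral_add_left (by fun_prop),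
      lintegral_add_left (by fun_prop), hone, ← hK] at h1
    simpa using h1
  generalize klDiv ν (volume.restrict (Set.Icc 0 B)) = K at hsum ⊢
  change ((∫⁻ t in Set.Icc 0 B, ENNReal.ofReal (Real.negMulLog (f t)) : ℝ≥0∞) : EReal)
    - ((∫⁻ t in Set.Icc 0 B, ENNReal.ofReal (-Real.negMulLog (f t)) : ℝ≥0∞) : EReal) = _
  generalize ∫⁻ t in Set.Icc 0 B, ENNReal.ofReal (Real.negMulLog (f t)) = P at hsum hP ⊢
  generalize ∫⁻ t in Set.Icc 0 B, ENNReal.ofReal (-Real.negMulLog (f t)) = Q at hsum ⊢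
  lift P to ℝ≥0 using hP
  rcases eq_or_ne K ∞ with rfl | hKt
  · have : Q = ∞ := by
      by_contra hQ
      rw [top_add, top_add] at hsum
      exact ENNReal.add_ne_top.2 ⟨hQ, ENNReal.ofReal_ne_top⟩ hsum.symm
    subst this
    simp [EReal.sub_top]
  · have hQ : Q ≠ ∞ := by
      rintro rfl
      rw [top_add] at hsum
      exact ENNReal.add_ne_top.2 ⟨ENNReal.add_ne_top.2 ⟨hKt, ENNReal.coe_ne_top⟩,
        ENNReal.one_ne_top⟩ hsum
    lift K to ℝ≥0 using hKt
    lift Q to ℝ≥0 using hQ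
    have h := congrArg ENNReal.toReal hsum
    rw [ENNReal.toReal_add (by simp) (by simp), ENNReal.toReal_add (by simp) (by simp),
      ENNReal.toReal_add (by simp) (by simp), ENNReal.toReal_ofReal hB] at h
    simp only [ENNReal.coe_toReal, ENNReal.toReal_one] at h
    change ((P : ℝ) : EReal) - ((Q : ℝ) : EReal) = ((B - 1 : ℝ) : EReal) - ((K : ℝ) : EReal)
    rw [← EReal.coe_sub, ← EReal.coe_sub]
    congr 1
    linarith

/-- Finite divergence means exactly absolute continuity and integrability of the log-density, the
hypotheses of the entropy power inequality. -/
lemma differentialEntropy_eq_bot_or (hB : 0 ≤ B) (hνB : ∀ᵐ x ∂ν, x ∈ Set.Icc 0 B) :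
    differentialEntropy ν = ⊥ ∨
      (ν ≪ volume ∧ Integrable (fun t => Real.log (ν.rnDeriv volume t).toReal) ν ∧
        differentialEntropy ν
          = ((-∫ t, Real.log (ν.rnDeriv volume t).toReal ∂ν : ℝ) : EReal)) := by
  rw [differentialEntropy_eq_sub_klDiv hB hνB]
  rcases eq_or_ne (klDiv ν (volume.restrict (Set.Icc 0 B))) ∞ with hK | hK
  · left; rw [hK]; simp [EReal.sub_top]
  right
  obtain ⟨hac', hint⟩ := klDiv_ne_top_iff.1 hK
  have hac := hac'.trans Measure.restrict_le_self.absolutelyContinuous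
  have hllr : llr ν (volume.restrict (Set.Icc 0 B)) =ᵐ[ν]
      fun t => Real.log (ν.rnDeriv volume t).toReal := by
    filter_upwards [hac'.ae_le (rnDeriv_restrict_ae_eq hνB hac)] with t ht
    rw [llr, ht]
  refine ⟨hac, hint.congr hllr, ?_⟩
  have h := toReal_klDiv hac' hint
  rw [integral_congr_ae hllr] at h
  have h2 : (volume.restrict (Set.Icc 0 B)).real Set.univ = B := by
    simp [measureReal_def, ENNReal.toReal_ofReal hB]
  rw [h2, probReal_univ] at h
  generalize klDiv ν (volume.restrict (Set.Icc 0 B)) = K at h hK ⊢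
  lift K to ℝ≥0 using hK
  change ((B - 1 : ℝ) : EReal) - ((K : ℝ) : EReal) = _
  rw [ENNReal.coe_toReal] at h
  rw [← EReal.coe_sub]
  congr 1
  linarith

end Entropy

/-! ### Weak continuity of the output entropy -/

/-- At each `y` the smoothed density integrates a bounded continuous function, so it is weakly
continuous; the bound uniform over laws on `[0, B]` permits dominated convergence. -/
lemma continuous_smoothedEntropy {K : Type*} [TopologicalSpace K] [FirstCountableTopology K]
    {N : K → ProbabilityMeasure ℝ} (hN : Continuous N) {B : ℝ}
    (hB : ∀ P, ∀ᵐ x ∂(N P : Measure ℝ), x ∈ Set.Icc 0 B) {v : ℝ≥0} (hv : v ≠ 0) :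
    Continuous fun P => smoothedEntropy (N P : Measure ℝ) v := by
  refine continuous_of_dominated (bound := smoothedEntropyBound v B) (fun P => ?_) (fun P => ?_)
    (integrable_smoothedEntropyBound hv B) (ae_of_all _ fun y => ?_)
  · exact (Real.continuous_negMulLog.measurable.comp
      (measurable_smoothedDensity _ v)).aestronglyMeasurable
  · exact ae_of_all _ fun y => abs_negMulLog_smoothedDensity_le hv (hB P) y
  · refine Real.continuous_negMulLog.comp ?_
    let g : BoundedContinuousFunction ℝ ℝ := BoundedContinuousFunction.ofNormedAddCommGroup
      (fun x => gaussianPDFReal x v y) (continuous_gaussianPDFReal_left v y)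
      (√(2 * Real.pi * v))⁻¹ fun x => by
        rw [Real.norm_of_nonneg (gaussianPDFReal_nonneg _ _ _)]
        exact gaussianPDFReal_le x v y
    exact (ProbabilityMeasure.continuous_integral_boundedContinuousFunction g).comp hN

/-! ### Measurability of the harvested power -/

namespace EHModel

variable (M : EHModel)

lemma measurableSet_piece (i : Fin M.N) : MeasurableSet (M.piece i) := by
  by_cases h : (i : ℕ) + 1 < M.N
  · have h' : M.piece i = Set.Icc (M.ρ i.castSucc) (M.ρ i.succ) ∩ Set.Iio (M.ρ i.succ) := by
      ext r; simp [piece, h]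
    rw [h']
    exact measurableSet_Icc.inter measurableSet_Iio
  · have h' : M.piece i = Set.Icc (M.ρ i.castSucc) (M.ρ i.succ) := by ext r; simp [piece, h]
    rw [h']
    exact measurableSet_Icc

lemma ordConnected_piece (i : Fin M.N) : (M.piece i).OrdConnected := by
  refine Set.ordConnected_of_Ioo fun x hx y hy _ z hz => ?_
  exact ⟨⟨hx.1.1.trans hz.1.le, hz.2.le.trans hy.1.2⟩, fun h => hz.2.trans (hy.2 h)⟩

/-- A superlevel set of a monotone function on an interval is order-connected. This is where
piecewise monotonicity enters. -/
lemma measurableSet_piece_inter_lt (i : Fin M.N) (c : ℝ) :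
    MeasurableSet (M.piece i ∩ {r | c < M.φ i r}) := by
  refine Set.OrdConnected.measurableSet (Set.ordConnected_of_Ioo fun x hx y hy _ z hz => ?_)
  have hzp : z ∈ M.piece i := (M.ordConnected_piece i).out hx.1 hy.1 ⟨hz.1.le, hz.2.le⟩
  refine ⟨hzp, ?_⟩
  rcases Nat.even_or_odd (i : ℕ) with he | ho
  · exact lt_of_lt_of_le hx.2 (M.φ_monotone i he hx.1 hzp hz.1.le)
  · exact lt_of_lt_of_le hy.2 (M.φ_antitone i ho hzp hy.1 hz.2.le)

lemma measurable_psi : Measurable M.psi := by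
  refine Finset.measurable_sum _ fun i _ => measurable_of_Ioi fun c => ?_
  have h : (M.piece i).indicator (M.φ i) ⁻¹' Set.Ioi c
      = (M.piece i ∩ {r | c < M.φ i r}) ∪ ((M.piece i)ᶜ ∩ {_r | c < 0}) := by
    ext r
    by_cases hr : r ∈ M.piece i <;> simp [hr]
  rw [h]
  exact (M.measurableSet_piece_inter_lt i c).union
    ((M.measurableSet_piece i).compl.inter (MeasurableSet.const _))

lemma ρmax_nonneg : 0 ≤ M.ρmax := by
  rw [← M.ρ_zero]
  exact M.ρ_mono (Fin.zero_le _)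

end EHModel

/-! ### Comparison of the two objectives for a fixed input law -/

section Channel

variable (M : EHModel) (h : ℂ)

lemma peakAmplitude_nonneg {A : ℝ} (hA : 0 ≤ A) : 0 ≤ peakAmplitude M h A :=
  le_min hA (by positivity)

lemma measurable_receivedPower : Measurable fun s : ℝ => M.psi (‖h * (s : ℂ)‖ ^ 2) :=
  M.measurable_psi.comp (by fun_prop)

lemma measurable_outputSignal : Measurable (outputSignal M h) :=
  (measurable_receivedPower M h).sqrt

variable {M h} {a Pmax Preq : ℝ}

lemma norm_sq_le_of_mem_Icc {s : ℝ} (hs : s ∈ Set.Icc 0 a) :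
    ‖h * (s : ℂ)‖ ^ 2 ≤ ‖h * (a : ℂ)‖ ^ 2 := by
  simp only [norm_mul, Complex.norm_real, Real.norm_eq_abs, abs_of_nonneg hs.1,
    abs_of_nonneg (hs.1.trans hs.2)]
  exact pow_le_pow_left₀ (mul_nonneg (norm_nonneg _) hs.1)
    (mul_le_mul_of_nonneg_left hs.2 (norm_nonneg _)) 2

lemma norm_sq_le_ρmax (hh : h ≠ 0) {A s : ℝ} (hs : s ∈ Set.Icc 0 (peakAmplitude M h A)) :
    ‖h * (s : ℂ)‖ ^ 2 ≤ M.ρmax := by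
  have hh' : 0 < ‖h‖ := norm_pos_iff.2 hh
  have h1 : s ≤ √M.ρmax / ‖h‖ := hs.2.trans (min_le_right _ _)
  rw [le_div_iff₀ hh'] at h1
  rw [norm_mul, Complex.norm_real, Real.norm_eq_abs, abs_of_nonneg hs.1, ← Real.sq_sqrt M.ρmax_nonneg]
  exact pow_le_pow_left₀ (mul_nonneg (norm_nonneg _) hs.1) (by linarith) 2

lemma outputSignal_mem_Icc (hP : ∀ r ∈ Set.Icc 0 (‖h * (a : ℂ)‖ ^ 2), M.psi r ≤ Pmax) {s : ℝ}
    (hs : s ∈ Set.Icc 0 a) : outputSignal M h s ∈ Set.Icc 0 √Pmax :=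
  ⟨Real.sqrt_nonneg _, Real.sqrt_le_sqrt (hP _ ⟨by positivity, norm_sq_le_of_mem_Icc hs⟩)⟩

lemma ae_mem_Icc_of_feasible {p : ProbabilityMeasure ℝ} (hp : p ∈ feasibleInputs M h a Preq) :
    ∀ᵐ s ∂(p : Measure ℝ), s ∈ Set.Icc 0 a :=
  mem_ae_iff.2 hp.1

lemma ae_map_outputSignal (hP : ∀ r ∈ Set.Icc 0 (‖h * (a : ℂ)‖ ^ 2), M.psi r ≤ Pmax)
    {p : ProbabilityMeasure ℝ} (hp : p ∈ feasibleInputs M h a Preq) :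
    ∀ᵐ x ∂((p : Measure ℝ).map (outputSignal M h)), x ∈ Set.Icc 0 √Pmax := by
  refine (ae_map_iff (measurable_outputSignal M h).aemeasurable measurableSet_Icc).2 ?_
  filter_upwards [ae_mem_Icc_of_feasible hp] with s hs
  exact outputSignal_mem_Icc hP hs

lemma channelMI_eq (hP : ∀ r ∈ Set.Icc 0 (‖h * (a : ℂ)‖ ^ 2), M.psi r ≤ Pmax)
    {p : ProbabilityMeasure ℝ} (hp : p ∈ feasibleInputs M h a Preq) {σ : ℝ} (hσ : 0 < σ) :
    channelMI M h σ p = (ENNReal.ofReal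
      (smoothedEntropy ((p : Measure ℝ).map (outputSignal M h)) (Real.toNNReal (σ ^ 2))
        - 1 / 2 * Real.log (2 * Real.pi * Real.exp 1 * σ ^ 2)) : EReal) := by
  have hv : Real.toNNReal (σ ^ 2) ≠ 0 := by simp [hσ.ne']
  rw [channelMI, inputOutputLaw, mutualInformation_additiveNoise (p : Measure ℝ) hv
    (measurable_outputSignal M h) (ae_map_outputSignal hP hp), Real.coe_toNNReal _ (sq_nonneg σ)]

/-- Reduces the maximization of `J` to that of the output entropy. -/
lemma achievableMI_mono {σ : ℝ} {p p' : ProbabilityMeasure ℝ}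
    (hpp : outputEntropy M h p ≤ outputEntropy M h p') :
    achievableMI M h σ p ≤ achievableMI M h σ p' := by
  have h2 : (2 : EReal) * outputEntropy M h p ≤ 2 * outputEntropy M h p' :=
    mul_le_mul_of_nonneg_left hpp (by norm_num)
  refine mul_le_mul_of_nonneg_left ?_ (by exact_mod_cast (by norm_num : (0 : ℝ) ≤ 1 / 2))
  refine ENNReal.log_monotone ?_
  gcongr

/-- The entropy power inequality for the channel. -/
theorem achievableMI_le_channelMI (hP : ∀ r ∈ Set.Icc 0 (‖h * (a : ℂ)‖ ^ 2), M.psi r ≤ Pmax)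
    {p : ProbabilityMeasure ℝ} (hp : p ∈ feasibleInputs M h a Preq) {σ : ℝ} (hσ : 0 < σ) :
    achievableMI M h σ p ≤ channelMI M h σ p := by
  have hB := ae_map_outputSignal hP hp
  have : IsProbabilityMeasure ((p : Measure ℝ).map (outputSignal M h)) :=
    Measure.isProbabilityMeasure_map (measurable_outputSignal M h).aemeasurable
  rcases differentialEntropy_eq_bot_or (Real.sqrt_nonneg Pmax) hB with hbot | ⟨hac, hint, he⟩
  · have h0 : achievableMI M h σ p = 0 := by
      rw [achievableMI, outputEntropy, hbot, EReal.mul_bot_of_pos (by norm_num)]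
      simp
    rw [h0]
    exact EReal.coe_ennreal_nonneg _
  · have hepi := half_log_one_add_exp_le_smoothedEntropy hB hac hint hσ
    set η := -∫ t, Real.log
      (((p : Measure ℝ).map (outputSignal M h)).rnDeriv volume t).toReal
        ∂((p : Measure ℝ).map (outputSignal M h)) with hη
    have hC : 0 < 2 * Real.pi * Real.exp 1 * σ ^ 2 := by positivity
    have h1 : achievableMI M h σ p = ((1 / 2 * Real.log (1 + Real.exp (2 * η)
        / (2 * Real.pi * Real.exp 1 * σ ^ 2)) : ℝ) : EReal) := by
      rw [achievableMI, outputEntropy, he,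
        show (2 : EReal) * (η : EReal) = ((2 * η : ℝ) : EReal) by rw [EReal.coe_mul]; rfl,
        EReal.exp_coe, ← ENNReal.ofReal_div_of_pos hC, ← ENNReal.ofReal_one,
        ← ENNReal.ofReal_add zero_le_one (by positivity),
        ENNReal.log_ofReal_of_pos (by positivity), ← EReal.coe_mul]
    rw [h1, channelMI_eq hP hp hσ, EReal.coe_ennreal_ofReal]
    exact EReal.coe_le_coe_iff.2 (hepi.trans (le_max_left _ _))

end Channel

/-! ### Compactness and attainment of the suprema -/

section Attainment

variable {M : EHModel} {h : ℂ} {a Pmax Preq : ℝ}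

/-- The law on `ℝ` of a random variable with values in `[0, a]`. -/
noncomputable def inputLaw (P : ProbabilityMeasure (Set.Icc 0 a)) : ProbabilityMeasure ℝ :=
  P.map measurable_subtype_coe.aemeasurable

/-- The laws on `[0, a]` with average harvested power at least `Preq`. -/
def compactFeasible (M : EHModel) (h : ℂ) (a Preq : ℝ) :
    Set (ProbabilityMeasure (Set.Icc 0 a)) :=
  {P | Preq ≤ ∫ s, M.psi (‖h * ((s : ℝ) : ℂ)‖ ^ 2) ∂(P : Measure (Set.Icc 0 a))}

lemma coe_inputLaw (P : ProbabilityMeasure (Set.Icc 0 a)) :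
    (inputLaw P : Measure ℝ) = (P : Measure (Set.Icc 0 a)).map Subtype.val := rfl

lemma avgHarvestedPower_inputLaw (P : ProbabilityMeasure (Set.Icc 0 a)) :
    avgHarvestedPower M h (inputLaw P)
      = ∫ s, M.psi (‖h * ((s : ℝ) : ℂ)‖ ^ 2) ∂(P : Measure (Set.Icc 0 a)) := by
  rw [avgHarvestedPower, coe_inputLaw, integral_map measurable_subtype_coe.aemeasurable
    (measurable_receivedPower M h).aestronglyMeasurable]

/-- Moves the problem to laws on the compact space `[0, a]`, whose probability measures form a
compact space. -/
lemma image_inputLaw_compactFeasible :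
    inputLaw '' compactFeasible M h a Preq = feasibleInputs M h a Preq := by
  ext p
  constructor
  · rintro ⟨P, hP, rfl⟩
    refine ⟨?_, hP.trans_eq (avgHarvestedPower_inputLaw P).symm⟩
    rw [coe_inputLaw, Measure.map_apply measurable_subtype_coe measurableSet_Icc.compl]
    simp
  · intro hp
    have hmap : ((p : Measure ℝ).comap ((↑) : Set.Icc 0 a → ℝ)).map Subtype.val
        = (p : Measure ℝ) := by
      rw [map_comap_subtype_coe measurableSet_Icc,
        Measure.restrict_eq_self_of_ae_mem (ae_mem_Icc_of_feasible hp)]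
    have hprob : IsProbabilityMeasure ((p : Measure ℝ).comap ((↑) : Set.Icc 0 a → ℝ)) := by
      refine ⟨?_⟩
      have h1 : ((p : Measure ℝ).comap ((↑) : Set.Icc 0 a → ℝ)).map Subtype.val Set.univ = 1 := by
        rw [hmap]; exact measure_univ
      rwa [Measure.map_apply measurable_subtype_coe MeasurableSet.univ] at h1
    let P : ProbabilityMeasure (Set.Icc 0 a) := ⟨_, hprob⟩
    have heq : inputLaw P = p := Subtype.ext hmap
    refine ⟨P, ?_, heq⟩
    have h2 : Preq ≤ avgHarvestedPower M h (inputLaw P) := heq ▸ hp.2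
    exact h2.trans_eq (avgHarvestedPower_inputLaw P)

/-- The witness is the point mass at `√r / ‖h‖`, where `r` is a received power at which `ψ` equals
`Pmax`. -/
lemma feasibleInputs_nonempty (hh : h ≠ 0) (ha : 0 ≤ a)
    (hPmax : Pmax ∈ M.psi '' Set.Icc 0 (‖h * (a : ℂ)‖ ^ 2)) (hPreq : Preq ≤ Pmax) :
    (feasibleInputs M h a Preq).Nonempty := by
  obtain ⟨r, hr, rfl⟩ := hPmax
  have hh' : 0 < ‖h‖ := norm_pos_iff.2 hh
  have hs : √r / ‖h‖ ∈ Set.Icc 0 a := by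
    refine ⟨by positivity, (div_le_iff₀ hh').2 (Real.sqrt_le_iff.2 ⟨by positivity, ?_⟩)⟩
    refine hr.2.trans_eq ?_
    rw [norm_mul, Complex.norm_real, Real.norm_eq_abs, abs_of_nonneg ha, mul_comm]
  have hr' : ‖h * ((√r / ‖h‖ : ℝ) : ℂ)‖ ^ 2 = r := by
    rw [norm_mul, Complex.norm_real, Real.norm_eq_abs, abs_of_nonneg hs.1,
      mul_div_cancel₀ _ hh'.ne', Real.sq_sqrt hr.1]
  refine ⟨⟨Measure.dirac (√r / ‖h‖), inferInstance⟩, ?_, ?_⟩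
  · simpa using hs
  · change Preq ≤ ∫ s, M.psi (‖h * (s : ℂ)‖ ^ 2) ∂Measure.dirac (√r / ‖h‖)
    rw [integral_dirac, hr']
    exact hPreq

lemma isCompact_compactFeasible
    (hcont : Continuous fun s : Set.Icc 0 a => M.psi (‖h * ((s : ℝ) : ℂ)‖ ^ 2)) :
    IsCompact (compactFeasible M h a Preq) :=
  (isClosed_le continuous_const (ProbabilityMeasure.continuous_integral_continuousMap
    (⟨_, hcont⟩ : C(Set.Icc 0 a, ℝ)))).isCompact

/-- The law on `ℝ` of the noiseless output, as a function of the input law on `[0, a]`. -/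
noncomputable def outputLaw (M : EHModel) (h : ℂ) (P : ProbabilityMeasure (Set.Icc 0 a)) :
    ProbabilityMeasure ℝ :=
  P.map (f := fun s : Set.Icc 0 a => outputSignal M h s)
    ((measurable_outputSignal M h).comp measurable_subtype_coe).aemeasurable

lemma coe_outputLaw (P : ProbabilityMeasure (Set.Icc 0 a)) :
    (outputLaw M h P : Measure ℝ) = (inputLaw P : Measure ℝ).map (outputSignal M h) := by
  rw [coe_inputLaw, Measure.map_map (measurable_outputSignal M h) measurable_subtype_coe]
  rfl

lemma continuous_outputLaw
    (hcont : Continuous fun s : Set.Icc 0 a => M.psi (‖h * ((s : ℝ) : ℂ)‖ ^ 2)) :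
    Continuous (outputLaw (a := a) M h) :=
  ProbabilityMeasure.continuous_map (Real.continuous_sqrt.comp hcont)

lemma ae_outputLaw (hP : ∀ r ∈ Set.Icc 0 (‖h * (a : ℂ)‖ ^ 2), M.psi r ≤ Pmax)
    (P : ProbabilityMeasure (Set.Icc 0 a)) :
    ∀ᵐ x ∂(outputLaw M h P : Measure ℝ), x ∈ Set.Icc 0 √Pmax :=
  (ae_map_iff ((measurable_outputSignal M h).comp measurable_subtype_coe).aemeasurable
    measurableSet_Icc).2 (ae_of_all _ fun s => outputSignal_mem_Icc hP s.2)

theorem exists_channelMI_eq_max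
    (hcont : Continuous fun s : Set.Icc 0 a => M.psi (‖h * ((s : ℝ) : ℂ)‖ ^ 2))
    (hP : ∀ r ∈ Set.Icc 0 (‖h * (a : ℂ)‖ ^ 2), M.psi r ≤ Pmax)
    (hne : (feasibleInputs M h a Preq).Nonempty) {σ : ℝ} (hσ : 0 < σ) :
    ∃ p ∈ feasibleInputs M h a Preq, channelMI M h σ p = maxChannelMI M h σ a Preq := by
  have hv : Real.toNNReal (σ ^ 2) ≠ 0 := by simp [hσ.ne']
  rw [← image_inputLaw_compactFeasible, Set.image_nonempty] at hne
  obtain ⟨P, hPm, hmax⟩ := (isCompact_compactFeasible hcont).exists_isMaxOn hne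
    (continuous_smoothedEntropy (continuous_outputLaw hcont) (ae_outputLaw hP) hv).continuousOn
  have hmem : ∀ P ∈ compactFeasible M h a Preq, inputLaw P ∈ feasibleInputs M h a Preq :=
    fun P hP => image_inputLaw_compactFeasible ▸ Set.mem_image_of_mem _ hP
  refine ⟨inputLaw P, hmem P hPm, le_antisymm (le_iSup₂ (f := fun p _ => channelMI M h σ p)
    _ (hmem P hPm)) (iSup₂_le fun p hp => ?_)⟩
  have hp' := hp
  rw [← image_inputLaw_compactFeasible] at hp'
  obtain ⟨Q, hQ, rfl⟩ := hp'
  rw [channelMI_eq hP hp hσ, channelMI_eq hP (hmem P hPm) hσ, EReal.coe_ennreal_le_coe_ennreal_iff,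
    ← coe_outputLaw, ← coe_outputLaw]
  exact ENNReal.ofReal_le_ofReal (sub_le_sub_right (hmax hQ) _)

/-- A lower semicontinuous function with values in `[0, ∞]` attains its minimum on a compact set, so
the case in which every feasible output has infinite divergence needs no separate treatment. -/
theorem exists_achievableMI_eq_max
    (hcont : Continuous fun s : Set.Icc 0 a => M.psi (‖h * ((s : ℝ) : ℂ)‖ ^ 2))
    (hP : ∀ r ∈ Set.Icc 0 (‖h * (a : ℂ)‖ ^ 2), M.psi r ≤ Pmax)
    (hne : (feasibleInputs M h a Preq).Nonempty) (σ : ℝ) :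
    ∃ p ∈ feasibleInputs M h a Preq, achievableMI M h σ p = maxAchievableMI M h σ a Preq := by
  rw [← image_inputLaw_compactFeasible, Set.image_nonempty] at hne
  obtain ⟨P, hPm, hmin⟩ := (((lowerSemicontinuous_klDiv (volume.restrict (Set.Icc 0 √Pmax))).comp
    (continuous_outputLaw hcont)).lowerSemicontinuousOn _).exists_isMinOn hne
    (isCompact_compactFeasible hcont)
  have hmem : ∀ P ∈ compactFeasible M h a Preq, inputLaw P ∈ feasibleInputs M h a Preq :=
    fun P hP => image_inputLaw_compactFeasible ▸ Set.mem_image_of_mem _ hP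
  refine ⟨inputLaw P, hmem P hPm, le_antisymm (le_iSup₂ (f := fun p _ => achievableMI M h σ p)
    _ (hmem P hPm)) (iSup₂_le fun p hp => ?_)⟩
  rw [← image_inputLaw_compactFeasible] at hp
  obtain ⟨Q, hQ, rfl⟩ := hp
  refine achievableMI_mono ?_
  rw [outputEntropy, outputEntropy, ← coe_outputLaw, ← coe_outputLaw,
    differentialEntropy_eq_sub_klDiv (Real.sqrt_nonneg Pmax) (ae_outputLaw hP Q),
    differentialEntropy_eq_sub_klDiv (Real.sqrt_nonneg Pmax) (ae_outputLaw hP P)]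
  exact EReal.sub_le_sub le_rfl (EReal.coe_ennreal_le_coe_ennreal_iff.2 (hmin hQ))

end Attainment

theorem lemma1 (M : EHModel) (h : ℂ) (hh : h ≠ 0) (σ : ℝ) (hσ : 0 < σ) (A : ℝ) (hA : 0 ≤ A)
    (Pmax : ℝ)
    (hPmax : IsGreatest (M.psi '' Set.Icc 0 (‖h * (peakAmplitude M h A : ℂ)‖ ^ 2)) Pmax)
    (Preq : ℝ) (hPreq : Preq ∈ Set.Icc 0 Pmax) :
    maxAchievableMI M h σ (peakAmplitude M h A) Preq
        ≤ maxChannelMI M h σ (peakAmplitude M h A) Preq ∧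
      (ContinuousOn M.psi (Set.Icc 0 M.ρmax) →
        (∃ p ∈ feasibleInputs M h (peakAmplitude M h A) Preq,
            channelMI M h σ p = maxChannelMI M h σ (peakAmplitude M h A) Preq) ∧
          ∃ p ∈ feasibleInputs M h (peakAmplitude M h A) Preq,
            achievableMI M h σ p = maxAchievableMI M h σ (peakAmplitude M h A) Preq) := by
  have hP : ∀ r ∈ Set.Icc 0 (‖h * (peakAmplitude M h A : ℂ)‖ ^ 2), M.psi r ≤ Pmax :=
    fun r hr => hPmax.2 (Set.mem_image_of_mem _ hr)
  refine ⟨iSup₂_mono fun p hp => achievableMI_le_channelMI hP hp hσ, fun hψ => ?_⟩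
  have hne := feasibleInputs_nonempty hh (peakAmplitude_nonneg M h hA) hPmax.1 hPreq.2
  -- The cap `√ρmax / ‖h‖` in the peak amplitude keeps the received power inside `[0, ρmax]`, where
  -- `ψ` is continuous.
  have hcont : Continuous fun s : Set.Icc 0 (peakAmplitude M h A) =>
      M.psi (‖h * ((s : ℝ) : ℂ)‖ ^ 2) :=
    hψ.comp_continuous (by fun_prop) fun s => ⟨by positivity, norm_sq_le_ρmax hh s.2⟩
  exact ⟨exists_channelMI_eq_max hcont hP hne hσ, exists_achievableMI_eq_max hcont hP hne σ⟩
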